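/- Let $\mathscr X$ be a complex manifold of dimension $r$ with a Kähler metric $G_{i\bar j}$, and suppose it is special Kähler, i.e. $\mathscr X$ is covered by holomorphic coordinate systems $a=(a^1,\dots,a^r)$ ("special coordinates"), each with a holomorphic prepotential $\mathcal F(a)$ such that in these coordinates $$G_{i\bar j}=2\,\mathrm{Im}\,\frac{\partial^2\mathcal F}{\partial a^i\partial a^j},$$ and on overlaps the vectors $(\partial\mathcal F/\partial a^i,\,a^i)$ of two such systems are related locally by a constant matrix in $Sp(2r,\mathbb R)$ followed by a constant complex shift. Let $$Y=-i\,\frac{\partial^3\mathcal F}{\partial a^i\partial a^j\partial a^k}\,da^i\otimes da^j\otimes da^k .$$ For a Kähler metric write, in arbitrary holomorphic coordinates, $R_{i\bar jk\bar l}=-\partial_k\partial_{\bar l}G_{i\bar j}+G^{\bar n m}\,\partial_kG_{i\bar n}\,\partial_{\bar l}G_{m\bar j}$ for the Riemann tensor, where $G^{\bar nm}$ is the inverse matrix of $G_{m\bar n}$; $R_{k\bar l}=G^{\bar ji}R_{i\bar jk\bar l}$ for the Ricci tensor; and $R=G^{\bar lk}R_{k\bar l}$ for the scalar curvature. Then $Y$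 is a well-defined (independent of the choice of special coordinates) holomorphic symmetric cubic form on $\mathscr X$, and in all holomorphic coordinates $$R_{i\bar jk\bar l}=G^{\bar nm}\,Y_{ikm}\,\overline{Y_{jln}} .$$ Moreover: (1) The Riemann tensor is Nakano non-negative, i.e. $R_{i\bar jk\bar l}\,u^{ik}\,\overline{u^{jl}}\ge 0$ for all tensors $u^{ij}$; hence the holomorphic bisectional curvatures $R_{i\bar jk\bar l}v^i\bar v^{j}w^k\bar w^{l}/(\|v\|^2\|w\|^2)$, for $v,w\neq0$, and the Ricci curvature are non-negative. (2) The scalar curvature is $R=\|Y\|^2:=Y_{ijk}\,G^{\bar l i}G^{\bar m j}G^{\bar n k}\,\overline{Y_{lmn}}$. Hence if $R$ vanishes at a point $p$, then $Y$ vanishes at $p$, and the full Riemann tensor vanishes at $p$. (3) The scalar curvature $R$ is a plurisubharmonic function: it is smooth and the matrix $\partial_i\partial_{\bar j}R$ is non-negative in all holomorphic coordinates. -/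

import Mathlib

open scoped Manifold ContDiff ComplexConjugate ComplexOrder Topology

noncomputable section

namespace SpecialKahler

/-- The model space `ℂ^r` of an `r`-dimensional complex manifold. -/
abbrev Cn (r : ℕ) : Type := Fin r → ℂ

section Derivatives

variable {r : ℕ}

/-- Complex partial derivative `∂f/∂z^i` of a holomorphic function. -/
def holPartial (i : Fin r) (f : Cn r → ℂ) (z : Cn r) : ℂ :=
  fderiv ℂ f z (Pi.single i 1)

/-- Wirtinger derivative `∂_i f = (∂f/∂x^i - √-1 ∂f/∂y^i) / 2`, where `z^i = x^i + √-1 y^i`,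
of a real-differentiable function. -/
def dz (i : Fin r) (f : Cn r → ℂ) (z : Cn r) : ℂ :=
  (fderiv ℝ f z (Pi.single i 1) - Complex.I * fderiv ℝ f z (Pi.single i Complex.I)) / 2

/-- Wirtinger derivative `∂_{ī} f = (∂f/∂x^i + √-1 ∂f/∂y^i) / 2`. -/
def dzbar (i : Fin r) (f : Cn r → ℂ) (z : Cn r) : ℂ :=
  (fderiv ℝ f z (Pi.single i 1) + Complex.I * fderiv ℝ f z (Pi.single i Complex.I)) / 2

end Derivatives

section Manifold

variable {r : ℕ} {M : Type*} [TopologicalSpace M] [ChartedSpace (Cn r) M]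

variable (r M) in
/-- The holomorphic coordinate charts of the complex manifold `M`. -/
abbrev holCharts : Set (OpenPartialHomeomorph M (Cn r)) :=
  IsManifold.maximalAtlas 𝓘(ℂ, Cn r) ω M


/-- The coordinate vector field `∂/∂z^i` of the chart `e`, at the point with coordinates `z`. -/
def coordVec (e : OpenPartialHomeomorph M (Cn r)) (z : Cn r) (i : Fin r) :
    TangentSpace 𝓘(ℂ, Cn r) (e.symm z) :=
  mfderiv 𝓘(ℂ, Cn r) 𝓘(ℂ, Cn r) e.symm z (Pi.single i 1 : Cn r)

/-- The components of a tangent vector at `p` in the chart `e`. -/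
def vecCoord (e : OpenPartialHomeomorph M (Cn r)) (p : M)
    (v : TangentSpace 𝓘(ℂ, Cn r) p) : Cn r :=
  mfderiv 𝓘(ℂ, Cn r) 𝓘(ℂ, Cn r) e p v

/-- The matrix `G_{i j̄}` of a field of sesquilinear forms in the chart `e`. -/
def formCoeff
    (h : ∀ p : M, TangentSpace 𝓘(ℂ, Cn r) p →ₗ[ℂ] TangentSpace 𝓘(ℂ, Cn r) p →ₗ⋆[ℂ] ℂ)
    (e : OpenPartialHomeomorph M (Cn r)) (z : Cn r) : Matrix (Fin r) (Fin r) ℂ :=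
  Matrix.of fun i j => h (e.symm z) (coordVec e z i) (coordVec e z j)

/-- A smooth function is plurisubharmonic if its complex Hessian `∂_i ∂_{j̄} f` is non-negative
in all holomorphic coordinates. (`0 ≤ w` for `w : ℂ` says that `w` is real and non-negative.) -/
def IsPlurisubharmonic (f : M → ℝ) : Prop :=
  ∀ e ∈ holCharts r M,
    ContDiffOn ℝ ∞ (fun z => f (e.symm z)) e.target ∧
    ∀ z ∈ e.target, ∀ v : Cn r,
      0 ≤ ∑ i, ∑ j, dz i (dzbar j (fun x => (f (e.symm x) : ℂ))) z * v i * conj (v j)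

variable (r M) in
/-- A Kähler metric: a smooth positive definite Hermitian form on the holomorphic tangent bundle,
linear in the first and antilinear in the second argument, whose fundamental form is closed,
that is, `∂_k G_{i j̄} = ∂_i G_{k j̄}`. -/
structure KahlerMetric where
  form : ∀ p : M, TangentSpace 𝓘(ℂ, Cn r) p →ₗ[ℂ] TangentSpace 𝓘(ℂ, Cn r) p →ₗ⋆[ℂ] ℂ
  hermitian : ∀ p u v, form p u v = conj (form p v u)
  pos : ∀ p v, v ≠ 0 → 0 < form p v v
  smooth : ∀ e ∈ holCharts r M, ∀ i j,
    ContDiffOn ℝ ∞ (fun z => formCoeff form e z i j) e.target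
  closed : ∀ e ∈ holCharts r M, ∀ z ∈ e.target, ∀ i j k,
    dz k (fun x => formCoeff form e x i j) z = dz i (fun x => formCoeff form e x k j) z

namespace KahlerMetric

variable (g : KahlerMetric r M) (e : OpenPartialHomeomorph M (Cn r)) (z : Cn r)

/-- The matrix `G_{i j̄}` of the metric in the chart `e`. -/
def coeff : Matrix (Fin r) (Fin r) ℂ := formCoeff g.form e z

/-- The inverse metric: `g.inv e z n m` is `G^{n̄ m}`, with `∑ m, G^{n̄ m} G_{m l̄} = δ_{n l}`. -/
def inv : Matrix (Fin r) (Fin r) ℂ := (g.coeff e z)⁻¹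

/-- The components of the Riemann tensor of the Kähler metric in the chart `e`,
`R_{i j̄ k l̄} = - ∂_k ∂_{l̄} G_{i j̄} + G^{n̄ m} ∂_k G_{i n̄} ∂_{l̄} G_{m j̄}`. -/
def riemann (i j k l : Fin r) : ℂ :=
  - dz k (dzbar l (fun x => g.coeff e x i j)) z +
    ∑ n, ∑ m, g.inv e z n m * dz k (fun x => g.coeff e x i n) z *
      dzbar l (fun x => g.coeff e x m j) z

/-- The Ricci tensor `R_{k l̄} = G^{j̄ i} R_{i j̄ k l̄}`. -/
def ricci (k l : Fin r) : ℂ :=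
  ∑ i, ∑ j, g.inv e z j i * g.riemann e z i j k l

/-- The contraction `G^{l̄ k} R_{k l̄}` in the chart `e`. -/
def scalarIn : ℂ :=
  ∑ k, ∑ l, g.inv e z l k * g.ricci e z k l

/-- The scalar curvature, as a function on `M`, computed at `p` in the preferred chart at `p`. -/
def scalar (p : M) : ℝ :=
  (g.scalarIn (chartAt (Cn r) p) (chartAt (Cn r) p p)).re

/-- Holomorphic bisectional curvature of the tangent vectors `v = v^i ∂_i` and `w = w^k ∂_k`. -/
def bisectional (v w : Cn r) : ℂ :=
  (∑ i, ∑ j, ∑ k, ∑ l, g.riemann e z i j k l * v i * conj (v j) * w k * conj (w l)) /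
    ((∑ i, ∑ j, g.coeff e z i j * v i * conj (v j)) *
      ∑ k, ∑ l, g.coeff e z k l * w k * conj (w l))

/-- Nakano non-negativity: `R_{i j̄ k l̄} u^{ik} ū^{j̄ l̄} ≥ 0` for all tensors `u`. -/
def IsNakanoNonneg : Prop :=
  ∀ e ∈ holCharts r M, ∀ z ∈ e.target, ∀ u : Fin r → Fin r → ℂ,
    0 ≤ ∑ i, ∑ j, ∑ k, ∑ l, g.riemann e z i j k l * u i k * conj (u j l)

/-- All holomorphic bisectional curvatures are non-negative. -/
def IsBisectionalNonneg : Prop :=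
  ∀ e ∈ holCharts r M, ∀ z ∈ e.target, ∀ v w : Cn r, v ≠ 0 → w ≠ 0 →
    0 ≤ g.bisectional e z v w

/-- The Ricci curvature is non-negative. -/
def IsRicciNonneg : Prop :=
  ∀ e ∈ holCharts r M, ∀ z ∈ e.target, ∀ v : Cn r,
    0 ≤ ∑ k, ∑ l, g.ricci e z k l * v k * conj (v l)

end KahlerMetric

/-- Local special coordinates `a^i` for the Kähler metric `g`: a holomorphic chart together with a
holomorphic prepotential `F(a)` such that `G_{i j̄} = 2 Im (∂² F / ∂a^i ∂a^j)`. -/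
structure SpecialCoordinates (g : KahlerMetric r M) where
  chart : OpenPartialHomeomorph M (Cn r)
  chart_mem : chart ∈ holCharts r M
  prepotential : Cn r → ℂ
  holomorphic : DifferentiableOn ℂ prepotential chart.target
  metric_eq : ∀ a ∈ chart.target, ∀ i j,
    g.coeff chart a i j = 2 * ((holPartial i (holPartial j prepotential) a).im : ℂ)

namespace SpecialCoordinates

variable {g : KahlerMetric r M}

/-- The periods `(∂F/∂a^i, a^i)` at a point. -/
def periods (x : SpecialCoordinates g) (p : M) : Fin r ⊕ Fin r → ℂ :=
  Sum.elim (fun i => holPartial i x.prepotential (x.chart p)) (x.chart p)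

/-- On overlaps the periods of two systems of special coordinates are related, locally, by a
constant real symplectic matrix and a constant shift. -/
def Compatible (x y : SpecialCoordinates g) : Prop :=
  ∀ p ∈ x.chart.source ∩ y.chart.source,
    ∃ P ∈ Matrix.symplecticGroup (Fin r) ℝ, ∃ c : Fin r ⊕ Fin r → ℂ,
      ∀ᶠ q in 𝓝 p, y.periods q = (P.map Complex.ofReal).mulVec (x.periods q) + c

/-- `∂³F / ∂a^i ∂a^j ∂a^k` at the point with special coordinates `a`. -/
def thirdDeriv (x : SpecialCoordinates g) (a : Cn r) (i j k : Fin r) : ℂ :=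
  holPartial i (holPartial j (holPartial k x.prepotential)) a

end SpecialCoordinates

/-- A special Kähler structure on a Kähler manifold: a covering by mutually compatible systems of
special coordinates. -/
structure SpecialStructure (g : KahlerMetric r M) where
  systems : Set (SpecialCoordinates g)
  cover : ∀ p : M, ∃ x ∈ systems, p ∈ x.chart.source
  compatible : ∀ x ∈ systems, ∀ y ∈ systems, x.Compatible y

namespace SpecialStructure

variable {g : KahlerMetric r M} (S : SpecialStructure g)

/-- A system of special coordinates around `p`. -/
def systemAt (p : M) : SpecialCoordinates g := (S.cover p).choose

/-- The cubic form `Y = -√-1 (∂³F / ∂a^i ∂a^j ∂a^k) da^i ⊗ da^j ⊗ da^k`, computed at `p` in a chosen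
system of special coordinates around `p`. -/
def cubicForm (p : M) (u v w : TangentSpace 𝓘(ℂ, Cn r) p) : ℂ :=
  ∑ i, ∑ j, ∑ k, -Complex.I * (S.systemAt p).thirdDeriv ((S.systemAt p).chart p) i j k *
    vecCoord (S.systemAt p).chart p u i * vecCoord (S.systemAt p).chart p v j *
    vecCoord (S.systemAt p).chart p w k

/-- The components `Y_{ijk}` in the chart `e`. -/
def Y (e : OpenPartialHomeomorph M (Cn r)) (z : Cn r) (i j k : Fin r) : ℂ :=
  S.cubicForm (e.symm z) (coordVec e z i) (coordVec e z j) (coordVec e z k)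

/-- The Hermitian norm `‖Y‖² = Y_{ijk} G^{l̄ i} G^{m̄ j} G^{n̄ k} Ȳ_{l̄ m̄ n̄}` in the chart `e`. -/
def normSqY (e : OpenPartialHomeomorph M (Cn r)) (z : Cn r) : ℂ :=
  ∑ i, ∑ j, ∑ k, ∑ l, ∑ m, ∑ n,
    S.Y e z i j k * g.inv e z l i * g.inv e z m j * g.inv e z n k * conj (S.Y e z l m n)

end SpecialStructure

end Manifold

end SpecialKahler

end

open SpecialKahler

/-! In special coordinates `G = 2 Im T = -i(T - T̄)`, where `T = ∂²F` is holomorphic and symmetric.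
Hence `∂_k G = -i ∂_k T` is the matrix of `Y` with one index `k`, `∂_l̄ G` is its adjoint, and `∂_k
∂_l̄ G = 0`, so the curvature is `∂G G⁻¹ ∂̄G = Y G⁻¹ Ȳ`. In any other chart the Jacobian `J` is
holomorphic and all terms containing derivatives of `J` cancel (`curvature_of_frame`). That `Y` is
well defined follows by differentiating the symplectic relation between periods twice
(`third_deriv_of_symplectic`).

Positivity is then algebra. The Nakano form at `u` is the `G⁻¹`-norm of the contraction `Y_{ikm}
u^{ik}`; bisectional curvature is the case `u = v ⊗ w`, and Ricci curvature is a sum of such values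
once `G⁻¹` is written as `BᴴB`. The scalar curvature is the norm of `Y` for `G⁻¹ ⊗ G⁻¹ ⊗ G⁻¹`, which
is positive definite, so it vanishes only with `Y`.

Plurisubharmonicity comes from a comparison that touches at one point
(`contDiffAt_and_levi_nonneg`). Fix `z`, let `H = 2 Im T`, `H₀ = H(z)`, and freeze the
antiholomorphic part: `Q = -i(T - T̄(z))` is holomorphic with `Q(z) = H₀`. Then `H ≤ Q H₀⁻¹ Qᴴ`,
with equality at `z`. Inverting, `H⁻¹ ≥ AᴴA` with `A` holomorphic, so `‖Y‖²` dominates a sum of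
squared moduli of holomorphic functions and equals it at `z`. The difference has a local minimum at
`z`, so its Levi form there is non-negative, and so is that of the sum of squares. -/

open scoped Manifold ContDiff ComplexConjugate ComplexOrder Topology

noncomputable section

namespace SpecialKahler

/-! ### Cauchy integrals: partial derivatives of holomorphic functions are holomorphic. -/

section Holomorphy

variable {r : ℕ}

/-- `f` is holomorphic near `z`. -/
def HolAt (f : Cn r → ℂ) (z : Cn r) : Prop := ∀ᶠ w in 𝓝 z, DifferentiableAt ℂ f w

/-- The one-variable Cauchy estimate on the line `t ↦ z + t v`, whose disc of radius `ρ / ‖v‖` stays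
in the ball. It supplies the bound that allows differentiation under the Cauchy integral in
`HolAt.holPartial`. -/
lemma norm_fderiv_le_of_ball {f : Cn r → ℂ} {z : Cn r} {ρ C : ℝ} (hρ : 0 < ρ)
    (hd : ∀ w ∈ Metric.closedBall z ρ, DifferentiableAt ℂ f w)
    (hC : ∀ w ∈ Metric.closedBall z ρ, ‖f w‖ ≤ C) : ‖fderiv ℂ f z‖ ≤ C / ρ := by
  have hC0 : 0 ≤ C := (norm_nonneg _).trans (hC z (Metric.mem_closedBall_self hρ.le))
  refine ContinuousLinearMap.opNorm_le_bound _ (by positivity) fun v => ?_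
  rcases eq_or_ne v 0 with rfl | hv
  · simp
  have hv' : 0 < ‖v‖ := norm_pos_iff.2 hv
  have hmem : ∀ t ∈ Metric.closedBall (0 : ℂ) (ρ / ‖v‖), z + t • v ∈ Metric.closedBall z ρ := by
    intro t ht
    rw [mem_closedBall_zero_iff] at ht
    rw [mem_closedBall_iff_norm, add_sub_cancel_left, norm_smul]
    exact (le_div_iff₀ hv').1 ht
  have hline : ∀ t, HasDerivAt (fun t : ℂ => z + t • v) v t := fun t => by
    simpa using ((hasDerivAt_id t).smul_const v).const_add z
  have hdiff : DifferentiableOn ℂ (fun t : ℂ => f (z + t • v))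
      (Metric.closedBall (0 : ℂ) (ρ / ‖v‖)) := fun t ht =>
    ((hd _ (hmem t ht)).hasFDerivAt.comp_hasDerivAt t
      (hline t)).differentiableAt.differentiableWithinAt
  have h := Complex.norm_deriv_le_of_forall_mem_sphere_norm_le (by positivity)
    (hdiff.mono Metric.closure_ball_subset_closedBall).diffContOnCl
    (fun t ht => hC _ (hmem t (Metric.sphere_subset_closedBall ht)))
  have h0 : HasDerivAt (fun t : ℂ => f (z + t • v)) (fderiv ℂ f z v) 0 := by
    have := (hd z (Metric.mem_closedBall_self hρ.le)).hasFDerivAt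
    have h' : HasFDerivAt f (fderiv ℂ f z) (z + (0 : ℂ) • v) := by simpa using this
    exact h'.comp_hasDerivAt 0 (hline 0)
  rw [h0.deriv] at h
  refine h.trans (le_of_eq ?_)
  field_simp

/-- Directional derivatives of holomorphic functions of several variables are holomorphic. -/
protected lemma HolAt.holPartial {f : Cn r → ℂ} {z₀ : Cn r} (hf : HolAt f z₀) (i : Fin r) :
    HolAt (holPartial i f) z₀ := by
  obtain ⟨R, hR, hball⟩ : ∃ R > 0, ∀ w ∈ Metric.ball z₀ R,
      DifferentiableAt ℂ f w ∧ ‖f w‖ ≤ ‖f z₀‖ + 1 := by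
    have h1 : ∀ᶠ w in 𝓝 z₀, ‖f w‖ ≤ ‖f z₀‖ + 1 :=
      (hf.self_of_nhds.continuousAt.norm.eventually_lt continuousAt_const
        (lt_add_one _)).mono fun _ h => h.le
    obtain ⟨R, hR, h⟩ := Metric.eventually_nhds_iff_ball.1 (Filter.Eventually.and hf h1)
    exact ⟨R, hR, h⟩
  set C := ‖f z₀‖ + 1
  set u : Cn r := Pi.single i 1 with hu
  have hu1 : ‖u‖ = 1 := by rw [hu, Pi.norm_single, norm_one]
  set ρ := R / 8 with hρ
  have hρ0 : 0 < ρ := by positivity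
  -- Radii: centres in the `R/4`-ball and circles of radius `R/8` stay in the `R/2`-ball, where a
  -- Cauchy estimate of radius `R/4` still fits inside the `R`-ball.
  have hbound : ∀ w ∈ Metric.ball z₀ (R / 2), ‖fderiv ℂ f w‖ ≤ C / (R / 4) := by
    intro w hw
    have hsub : Metric.closedBall w (R / 4) ⊆ Metric.ball z₀ R :=
      Metric.closedBall_subset_ball' (by rw [Metric.mem_ball] at hw; linarith)
    exact norm_fderiv_le_of_ball (by positivity) (fun x hx => (hball x (hsub hx)).1)
      fun x hx => (hball x (hsub hx)).2
  have hmem : ∀ w ∈ Metric.ball z₀ (R / 4), ∀ t : ℂ, ‖t‖ ≤ ρ →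
      w + t • u ∈ Metric.ball z₀ (R / 2) := by
    intro w hw t ht
    rw [mem_ball_iff_norm] at hw ⊢
    calc ‖w + t • u - z₀‖ = ‖(w - z₀) + t • u‖ := by congr 1; abel
      _ ≤ ‖w - z₀‖ + ‖t‖ * ‖u‖ := (norm_add_le _ _).trans (by rw [norm_smul])
      _ < R / 2 := by rw [hu1]; linarith
  have hhalf : Metric.ball z₀ (R / 2) ⊆ Metric.ball z₀ R := Metric.ball_subset_ball (by linarith)
  have hd : ∀ w ∈ Metric.ball z₀ (R / 4), ∀ t : ℂ, ‖t‖ ≤ ρ → DifferentiableAt ℂ f (w + t • u) :=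
    fun w hw t ht => (hball _ (hhalf (hmem w hw t ht))).1
  have hline : ∀ w : Cn r, ∀ t, HasDerivAt (fun t : ℂ => w + t • u) u t := fun w t => by
    simpa using ((hasDerivAt_id t).smul_const u).const_add w
  -- Cauchy's formula on a circle in the `i`-th direction expresses the derivative through values of
  -- `f` alone, so it can be differentiated in `w` under the integral.
  have hcauchy : ∀ w ∈ Metric.ball z₀ (R / 4), holPartial i f w =
      (2 * Real.pi * Complex.I)⁻¹ * ∫ θ in (0 : ℝ)..2 * Real.pi,
        deriv (circleMap 0 ρ) θ * (1 / (circleMap 0 ρ θ) ^ 2) * f (w + circleMap 0 ρ θ • u) := by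
    intro w hw
    have hdiff : DifferentiableOn ℂ (fun t : ℂ => f (w + t • u)) (Metric.closedBall 0 ρ) :=
      fun t ht => ((hd w hw t (by simpa using ht)).hasFDerivAt.comp_hasDerivAt t
        (hline w t)).differentiableAt.differentiableWithinAt
    have h := hdiff.deriv_eq_smul_circleIntegral hρ0
    have h0 : HasDerivAt (fun t : ℂ => f (w + t • u)) (fderiv ℂ f w u) 0 := by
      have h' : HasFDerivAt f (fderiv ℂ f w) (w + (0 : ℂ) • u) := by
        simpa using (hd w hw 0 (by simpa using hρ0.le)).hasFDerivAt
      exact h'.comp_hasDerivAt 0 (hline w 0)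
    rw [h0.deriv] at h
    have hne : (2 * Real.pi * Complex.I : ℂ) ≠ 0 := Complex.two_pi_I_ne_zero
    rw [show holPartial i f w = fderiv ℂ f w u from rfl, eq_inv_mul_iff_mul_eq₀ hne]
    rw [smul_eq_mul] at h
    rw [← h, circleIntegral]
    simp [mul_assoc]
  have hcirc : ∀ θ, ‖circleMap 0 ρ θ‖ = ρ := fun θ => by simp [abs_of_pos hρ0]
  have hcont0 : Continuous fun θ => deriv (circleMap 0 ρ) θ * (1 / (circleMap 0 ρ θ) ^ 2) := by
    simp only [deriv_circleMap]
    refine Continuous.mul (by fun_prop) (continuous_const.div (by fun_prop) fun θ => ?_)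
    exact pow_ne_zero _ (circleMap_ne_center hρ0.ne')
  have hcont : ∀ w ∈ Metric.ball z₀ (R / 4), Continuous fun θ =>
      deriv (circleMap 0 ρ) θ * (1 / (circleMap 0 ρ θ) ^ 2) * f (w + circleMap 0 ρ θ • u) := by
    intro w hw
    refine hcont0.mul (continuous_iff_continuousAt.2 fun θ => ?_)
    exact (hd w hw _ (hcirc θ).le).continuousAt.comp (f := fun θ => w + circleMap 0 ρ θ • u)
      (by fun_prop)
  have hfd : ∀ w ∈ Metric.ball z₀ (R / 4), DifferentiableAt ℂ (fun w =>
      ∫ θ in (0 : ℝ)..2 * Real.pi,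
        deriv (circleMap 0 ρ) θ * (1 / (circleMap 0 ρ θ) ^ 2) * f (w + circleMap 0 ρ θ • u)) w := by
    intro w hw
    have hnhds : Metric.ball z₀ (R / 4) ∈ 𝓝 w := Metric.isOpen_ball.mem_nhds hw
    refine (intervalIntegral.hasFDerivAt_integral_of_dominated_of_fderiv_le
      (F' := fun w θ => (deriv (circleMap 0 ρ) θ * (1 / (circleMap 0 ρ θ) ^ 2)) •
        fderiv ℂ f (w + circleMap 0 ρ θ • u))
      (bound := fun θ => ‖deriv (circleMap 0 ρ) θ * (1 / (circleMap 0 ρ θ) ^ 2)‖ * (C / (R / 4)))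
      hnhds ?_ ?_ ?_ ?_ ?_ ?_).differentiableAt
    · filter_upwards [hnhds] with x hx using (hcont x hx).aestronglyMeasurable
    · exact (hcont w hw).intervalIntegrable _ _
    -- Continuity of `fderiv ℂ f` is not yet known; its measurability is unconditional and suffices.
    · have hm : Measurable fun θ => fderiv ℂ f (w + circleMap 0 ρ θ • u) :=
        (measurable_fderiv ℂ f).comp (by fun_prop : Continuous _).measurable
      exact (hcont0.aestronglyMeasurable.smul hm.aestronglyMeasurable)
    · refine Filter.Eventually.of_forall fun θ _ x hx => ?_
      rw [norm_smul]
      exact mul_le_mul_of_nonneg_left (hbound _ (hmem x hx _ (hcirc θ).le)) (norm_nonneg _)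
    · exact (hcont0.norm.mul continuous_const).intervalIntegrable _ _
    · refine Filter.Eventually.of_forall fun θ _ x hx => ?_
      have h1 := (hd x hx _ (hcirc θ).le).hasFDerivAt
      have h2 : HasFDerivAt (fun x : Cn r => x + circleMap 0 ρ θ • u)
          (ContinuousLinearMap.id ℂ (Cn r)) x := (hasFDerivAt_id x).add_const _
      simpa using (h1.comp x h2).const_mul _
  have hopen : ∀ᶠ w in 𝓝 z₀, w ∈ Metric.ball z₀ (R / 4) :=
    Metric.ball_mem_nhds _ (by positivity)
  filter_upwards [hopen] with w hw
  have : holPartial i f =ᶠ[𝓝 w] _ :=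
    Filter.eventually_of_mem (Metric.isOpen_ball.mem_nhds hw) hcauchy
  exact ((hfd w hw).const_mul _).congr_of_eventuallyEq this

end Holomorphy

/-! ### Calculus of holomorphic functions of several variables. -/

section HolomorphicFunctions

variable {r : ℕ} {f g : Cn r → ℂ} {z : Cn r}

lemma HolAt.differentiableAt (hf : HolAt f z) : DifferentiableAt ℂ f z := hf.self_of_nhds

lemma HolAt.eventually (hf : HolAt f z) : ∀ᶠ w in 𝓝 z, HolAt f w := eventually_eventually_nhds.2 hf

lemma HolAt.real (hf : HolAt f z) : DifferentiableAt ℝ f z := hf.differentiableAt.restrictScalars ℝ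

lemma HolAt.congr (hf : HolAt f z) (h : g =ᶠ[𝓝 z] f) : HolAt g z := by
  filter_upwards [hf, h.eventuallyEq_nhds] with w h1 h2 using h1.congr_of_eventuallyEq h2

lemma holAt_const (c : ℂ) : HolAt (fun _ : Cn r => c) z :=
  Filter.Eventually.of_forall fun _ => differentiableAt_const c

lemma HolAt.add (hf : HolAt f z) (hg : HolAt g z) : HolAt (fun w => f w + g w) z := by
  filter_upwards [hf, hg] with w h1 h2 using h1.add h2

lemma HolAt.sub (hf : HolAt f z) (hg : HolAt g z) : HolAt (fun w => f w - g w) z := by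
  filter_upwards [hf, hg] with w h1 h2 using h1.sub h2

lemma HolAt.mul (hf : HolAt f z) (hg : HolAt g z) : HolAt (fun w => f w * g w) z := by
  filter_upwards [hf, hg] with w h1 h2 using h1.mul h2

lemma HolAt.sum {ι : Type*} {s : Finset ι} {F : ι → Cn r → ℂ} (hF : ∀ i ∈ s, HolAt (F i) z) :
    HolAt (fun w => ∑ i ∈ s, F i w) z := by
  have : ∀ᶠ w in 𝓝 z, ∀ i ∈ s, DifferentiableAt ℂ (F i) w := (Filter.eventually_all_finset s).2 hF
  filter_upwards [this] with w h using DifferentiableAt.fun_sum h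

lemma HolAt.comp {φ : Cn r → Cn r} (hf : HolAt f (φ z)) (hφ : ∀ i, HolAt (fun w => φ w i) z) :
    HolAt (fun w => f (φ w)) z := by
  have hφ' : ∀ᶠ w in 𝓝 z, DifferentiableAt ℂ φ w := by
    filter_upwards [Filter.eventually_all.2 hφ] with w h using differentiableAt_pi.2 h
  have := hφ'.self_of_nhds.continuousAt.eventually hf
  filter_upwards [this, hφ'] with w h1 h2 using h1.comp w h2

lemma fderiv_apply_eq_sum_holPartial (f : Cn r → ℂ) (z v : Cn r) :
    fderiv ℂ f z v = ∑ i, holPartial i f z * v i := by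
  conv_lhs => rw [pi_eq_sum_univ' v]
  simp only [map_sum, map_smul, smul_eq_mul, holPartial]
  refine Finset.sum_congr rfl fun i _ => ?_
  rw [mul_comm]

/-- The differential is a combination of constant functionals whose coefficients, the partial
derivatives, are again holomorphic, so induction on `n` applies to them. -/
lemma HolAt.contDiffAt_nat (n : ℕ) : ∀ {f : Cn r → ℂ}, HolAt f z → ContDiffAt ℂ n f z := by
  induction n with
  | zero =>
    intro f hf
    have : ContDiffOn ℂ 0 f {w | DifferentiableAt ℂ f w} :=
      contDiffOn_zero.2 fun w hw => DifferentiableAt.continuousAt hw |>.continuousWithinAt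
    exact this.contDiffAt hf
  | succ n ih =>
    intro f hf
    refine contDiffAt_succ_iff_hasFDerivAt.2 ⟨fderiv ℂ f,
      ⟨_, hf, fun w hw => DifferentiableAt.hasFDerivAt hw⟩, ?_⟩
    have : fderiv ℂ f = fun w => ∑ i, holPartial i f w • ContinuousLinearMap.proj (R := ℂ)
        (φ := fun _ : Fin r => ℂ) i := by
      funext w
      ext v
      rw [fderiv_apply_eq_sum_holPartial]
      simp
    rw [this]
    exact ContDiffAt.sum fun i _ => (ih (hf.holPartial i)).smul contDiffAt_const

lemma HolAt.contDiffAt (hf : HolAt f z) : ContDiffAt ℂ ∞ f z :=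
  contDiffAt_infty.2 fun n => hf.contDiffAt_nat n

lemma HolAt.contDiffAt_real (hf : HolAt f z) : ContDiffAt ℝ ∞ f z := hf.contDiffAt.restrict_scalars ℝ

lemma holAt_of_contDiffAt (hf : ContDiffAt ℂ ∞ f z) : HolAt f z :=
  ((hf.of_le (m := 1) (by exact_mod_cast le_top)).eventually (by simp)).mono
    fun _ h => h.differentiableAt one_ne_zero

lemma HolAt.holPartial_comm (hf : HolAt f z) (i j : Fin r) :
    holPartial i (holPartial j f) z = holPartial j (holPartial i f) z := by
  have h2 := hf.contDiffAt_nat 2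
  have hd : DifferentiableAt ℂ (fderiv ℂ f) z :=
    (h2.fderiv_right (m := 1) (by norm_num)).differentiableAt one_ne_zero
  have key : ∀ i j, holPartial i (holPartial j f) z =
      fderiv ℂ (fderiv ℂ f) z (Pi.single i 1) (Pi.single j 1) := by
    intro i j
    have : HasFDerivAt (fun w => fderiv ℂ f w (Pi.single j 1)) _ z :=
      hd.hasFDerivAt.clm_apply (hasFDerivAt_const (Pi.single j 1 : Cn r) z)
    change fderiv ℂ (fun w => fderiv ℂ f w (Pi.single j 1)) z (Pi.single i 1) = _
    rw [this.fderiv]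
    simp
  rw [key, key]
  exact h2.isSymmSndFDerivAt (by simp) _ _

lemma holPartial_congr (h : f =ᶠ[𝓝 z] g) (i : Fin r) : holPartial i f z = holPartial i g z := by
  rw [holPartial, holPartial, h.fderiv_eq]

lemma holPartial_comp {φ : Cn r → Cn r} (hf : DifferentiableAt ℂ f (φ z))
    (hφ : DifferentiableAt ℂ φ z) (k : Fin r) :
    holPartial k (fun w => f (φ w)) z =
      ∑ c, holPartial c f (φ z) * holPartial k (fun w => φ w c) z := by
  have h := (hf.hasFDerivAt.comp z hφ.hasFDerivAt).fderiv
  change fderiv ℂ (f ∘ φ) z _ = _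
  rw [h, ContinuousLinearMap.comp_apply, fderiv_apply_eq_sum_holPartial]
  refine Finset.sum_congr rfl fun c _ => ?_
  congr 1
  have := (hasFDerivAt_pi'.1 hφ.hasFDerivAt c).fderiv
  rw [holPartial, this]
  rfl

end HolomorphicFunctions

/-! ### Rules for the Wirtinger derivatives. -/

section Wirtinger

variable {r : ℕ} {f g : Cn r → ℂ} {z : Cn r}

lemma dz_congr (h : f =ᶠ[𝓝 z] g) (i : Fin r) : dz i f z = dz i g z := by
  rw [dz, dz, h.fderiv_eq]

lemma dzbar_congr (h : f =ᶠ[𝓝 z] g) (i : Fin r) : dzbar i f z = dzbar i g z := by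
  rw [dzbar, dzbar, h.fderiv_eq]

lemma dz_const (c : ℂ) (i : Fin r) : dz i (fun _ => c) z = 0 := by simp [dz]

lemma dzbar_const (c : ℂ) (i : Fin r) : dzbar i (fun _ => c) z = 0 := by simp [dzbar]

lemma dz_add (hf : DifferentiableAt ℝ f z) (hg : DifferentiableAt ℝ g z) (i : Fin r) :
    dz i (fun w => f w + g w) z = dz i f z + dz i g z := by
  simp only [dz, fderiv_fun_add hf hg, add_apply]
  ring

lemma dzbar_add (hf : DifferentiableAt ℝ f z) (hg : DifferentiableAt ℝ g z) (i : Fin r) :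
    dzbar i (fun w => f w + g w) z = dzbar i f z + dzbar i g z := by
  simp only [dzbar, fderiv_fun_add hf hg, add_apply]
  ring

lemma dz_mul (hf : DifferentiableAt ℝ f z) (hg : DifferentiableAt ℝ g z) (i : Fin r) :
    dz i (fun w => f w * g w) z = dz i f z * g z + f z * dz i g z := by
  simp only [dz, fderiv_fun_mul hf hg, add_apply, smul_apply, smul_eq_mul]
  ring

lemma dzbar_mul (hf : DifferentiableAt ℝ f z) (hg : DifferentiableAt ℝ g z) (i : Fin r) :
    dzbar i (fun w => f w * g w) z = dzbar i f z * g z + f z * dzbar i g z := by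
  simp only [dzbar, fderiv_fun_mul hf hg, add_apply, smul_apply, smul_eq_mul]
  ring

lemma dz_sum {ι : Type*} {s : Finset ι} {F : ι → Cn r → ℂ}
    (hF : ∀ i ∈ s, DifferentiableAt ℝ (F i) z) (k : Fin r) :
    dz k (fun w => ∑ i ∈ s, F i w) z = ∑ i ∈ s, dz k (F i) z := by
  simp only [dz, fderiv_fun_sum hF, sum_apply]
  rw [Finset.mul_sum, ← Finset.sum_sub_distrib, Finset.sum_div]

lemma dzbar_sum {ι : Type*} {s : Finset ι} {F : ι → Cn r → ℂ}
    (hF : ∀ i ∈ s, DifferentiableAt ℝ (F i) z) (k : Fin r) :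
    dzbar k (fun w => ∑ i ∈ s, F i w) z = ∑ i ∈ s, dzbar k (F i) z := by
  simp only [dzbar, fderiv_fun_sum hF, sum_apply]
  rw [Finset.mul_sum, ← Finset.sum_add_distrib, Finset.sum_div]

lemma fderiv_conj_apply (hf : DifferentiableAt ℝ f z) (v : Cn r) :
    fderiv ℝ (fun w => conj (f w)) z v = conj (fderiv ℝ f z v) := by
  have := (Complex.conjCLE.toContinuousLinearMap.hasFDerivAt.comp z hf.hasFDerivAt).fderiv
  change fderiv ℝ (Complex.conjCLE ∘ f) z v = _
  rw [show (Complex.conjCLE ∘ f) = ⇑(Complex.conjCLE.toContinuousLinearMap) ∘ f from rfl, this]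
  simp

lemma differentiableAt_conj (hf : DifferentiableAt ℝ f z) :
    DifferentiableAt ℝ (fun w => conj (f w)) z :=
  Complex.conjCLE.toContinuousLinearMap.differentiableAt.comp z hf

lemma dz_conj (hf : DifferentiableAt ℝ f z) (i : Fin r) :
    dz i (fun w => conj (f w)) z = conj (dzbar i f z) := by
  simp [dz, dzbar, fderiv_conj_apply hf, sub_eq_add_neg, Complex.conj_ofNat]

lemma dzbar_conj (hf : DifferentiableAt ℝ f z) (i : Fin r) :
    dzbar i (fun w => conj (f w)) z = conj (dz i f z) := by
  simp [dz, dzbar, fderiv_conj_apply hf, Complex.conj_ofNat]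

lemma HolAt.dz_eq (hf : HolAt f z) (i : Fin r) : dz i f z = holPartial i f z := by
  have h := hf.differentiableAt.fderiv_restrictScalars ℝ
  have hI : (Pi.single i Complex.I : Cn r) = Complex.I • Pi.single i 1 := by
    rw [← Pi.single_smul]; simp
  simp only [dz, holPartial, h, ContinuousLinearMap.coe_restrictScalars', hI, map_smul, smul_eq_mul]
  rw [← mul_assoc, Complex.I_mul_I]
  ring

lemma HolAt.dzbar_eq (hf : HolAt f z) (i : Fin r) : dzbar i f z = 0 := by
  have h := hf.differentiableAt.fderiv_restrictScalars ℝ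
  have hI : (Pi.single i Complex.I : Cn r) = Complex.I • Pi.single i 1 := by
    rw [← Pi.single_smul]; simp
  simp only [dzbar, h, ContinuousLinearMap.coe_restrictScalars', hI, map_smul, smul_eq_mul]
  rw [← mul_assoc, Complex.I_mul_I]
  ring

end Wirtinger

/-! ### Wirtinger calculus for matrix-valued functions. -/

section MatrixCalculus

variable {r : ℕ} {A B : Cn r → Matrix (Fin r) (Fin r) ℂ} {z : Cn r}

/-- Entrywise real differentiability of a matrix-valued function. -/
def MatDiffAt (A : Cn r → Matrix (Fin r) (Fin r) ℂ) (z : Cn r) : Prop :=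
  ∀ i j, DifferentiableAt ℝ (fun w => A w i j) z

/-- Entrywise holomorphy of a matrix-valued function. -/
def MatHolAt (A : Cn r → Matrix (Fin r) (Fin r) ℂ) (z : Cn r) : Prop :=
  ∀ i j, HolAt (fun w => A w i j) z

/-- Entrywise `∂_k`. -/
def matDz (k : Fin r) (A : Cn r → Matrix (Fin r) (Fin r) ℂ) (z : Cn r) :
    Matrix (Fin r) (Fin r) ℂ := Matrix.of fun i j => dz k (fun w => A w i j) z

/-- Entrywise `∂_{k̄}`. -/
def matDzbar (k : Fin r) (A : Cn r → Matrix (Fin r) (Fin r) ℂ) (z : Cn r) :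
    Matrix (Fin r) (Fin r) ℂ := Matrix.of fun i j => dzbar k (fun w => A w i j) z

/-- Entrywise complex partial derivative. -/
def matHolPartial (k : Fin r) (A : Cn r → Matrix (Fin r) (Fin r) ℂ) (z : Cn r) :
    Matrix (Fin r) (Fin r) ℂ := Matrix.of fun i j => holPartial k (fun w => A w i j) z

lemma MatHolAt.matDiffAt (hA : MatHolAt A z) : MatDiffAt A z := fun i j => (hA i j).real

lemma MatHolAt.eventually (hA : MatHolAt A z) : ∀ᶠ w in 𝓝 z, MatHolAt A w :=
  Filter.eventually_all.2 fun i => Filter.eventually_all.2 fun j => (hA i j).eventually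

protected lemma MatHolAt.matHolPartial (hA : MatHolAt A z) (k : Fin r) : MatHolAt (matHolPartial k A) z :=
  fun i j => (hA i j).holPartial k

protected lemma MatDiffAt.mul (hA : MatDiffAt A z) (hB : MatDiffAt B z) :
    MatDiffAt (fun w => A w * B w) z := fun i j => by
  simp only [Matrix.mul_apply]
  exact DifferentiableAt.fun_sum fun l _ => (hA i l).mul (hB l j)

protected lemma MatDiffAt.add (hA : MatDiffAt A z) (hB : MatDiffAt B z) :
    MatDiffAt (fun w => A w + B w) z := fun i j => (hA i j).add (hB i j)

protected lemma MatDiffAt.smul (c : ℂ) (hA : MatDiffAt A z) : MatDiffAt (fun w => c • A w) z :=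
  fun i j => (hA i j).const_mul c

protected lemma MatDiffAt.transpose (hA : MatDiffAt A z) : MatDiffAt (fun w => (A w).transpose) z :=
  fun i j => hA j i

protected lemma MatDiffAt.conj (hA : MatDiffAt A z) : MatDiffAt (fun w => (A w).map (starRingEnd ℂ)) z :=
  fun i j => differentiableAt_conj (hA i j)

lemma matDz_congr (h : A =ᶠ[𝓝 z] B) (k : Fin r) : matDz k A z = matDz k B z := by
  ext i j
  exact dz_congr (h.mono fun w hw => by simp [hw]) k

lemma matDzbar_congr (h : A =ᶠ[𝓝 z] B) (k : Fin r) : matDzbar k A z = matDzbar k B z := by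
  ext i j
  exact dzbar_congr (h.mono fun w hw => by simp [hw]) k

lemma matDz_mul (hA : MatDiffAt A z) (hB : MatDiffAt B z) (k : Fin r) :
    matDz k (fun w => A w * B w) z = matDz k A z * B z + A z * matDz k B z := by
  ext i j
  simp only [matDz, Matrix.of_apply, Matrix.mul_apply, Matrix.add_apply]
  rw [dz_sum (F := fun l w => A w i l * B w l j) fun l _ => (hA i l).mul (hB l j),
    ← Finset.sum_add_distrib]
  exact Finset.sum_congr rfl fun l _ => dz_mul (hA i l) (hB l j) k

lemma matDzbar_mul (hA : MatDiffAt A z) (hB : MatDiffAt B z) (k : Fin r) :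
    matDzbar k (fun w => A w * B w) z = matDzbar k A z * B z + A z * matDzbar k B z := by
  ext i j
  simp only [matDzbar, Matrix.of_apply, Matrix.mul_apply, Matrix.add_apply]
  rw [dzbar_sum (F := fun l w => A w i l * B w l j) fun l _ => (hA i l).mul (hB l j),
    ← Finset.sum_add_distrib]
  exact Finset.sum_congr rfl fun l _ => dzbar_mul (hA i l) (hB l j) k

lemma matDz_add (hA : MatDiffAt A z) (hB : MatDiffAt B z) (k : Fin r) :
    matDz k (fun w => A w + B w) z = matDz k A z + matDz k B z := by
  ext i j
  exact dz_add (hA i j) (hB i j) k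

lemma matDzbar_add (hA : MatDiffAt A z) (hB : MatDiffAt B z) (k : Fin r) :
    matDzbar k (fun w => A w + B w) z = matDzbar k A z + matDzbar k B z := by
  ext i j
  exact dzbar_add (hA i j) (hB i j) k

lemma matDz_smul (c : ℂ) (hA : MatDiffAt A z) (k : Fin r) :
    matDz k (fun w => c • A w) z = c • matDz k A z := by
  ext i j
  have := dz_mul (differentiableAt_const c) (hA i j) k
  simpa [matDz, dz_const] using this

lemma matDzbar_smul (c : ℂ) (hA : MatDiffAt A z) (k : Fin r) :
    matDzbar k (fun w => c • A w) z = c • matDzbar k A z := by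
  ext i j
  have := dzbar_mul (differentiableAt_const c) (hA i j) k
  simpa [matDzbar, dzbar_const] using this

lemma matDz_transpose (k : Fin r) :
    matDz k (fun w => (A w).transpose) z = (matDz k A z).transpose := rfl

lemma matDzbar_transpose (k : Fin r) :
    matDzbar k (fun w => (A w).transpose) z = (matDzbar k A z).transpose := rfl

lemma MatHolAt.matDz_eq (hA : MatHolAt A z) (k : Fin r) : matDz k A z = matHolPartial k A z := by
  ext i j
  exact (hA i j).dz_eq k

lemma MatHolAt.matDzbar_eq (hA : MatHolAt A z) (k : Fin r) : matDzbar k A z = 0 := by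
  ext i j
  exact (hA i j).dzbar_eq k

lemma MatHolAt.matDz_conj (hA : MatHolAt A z) (k : Fin r) :
    matDz k (fun w => (A w).map (starRingEnd ℂ)) z = 0 := by
  ext i j
  simp only [matDz, Matrix.of_apply, Matrix.map_apply, Matrix.zero_apply]
  rw [dz_conj (hA i j).real, (hA i j).dzbar_eq, map_zero]

lemma MatHolAt.matDzbar_conj (hA : MatHolAt A z) (k : Fin r) :
    matDzbar k (fun w => (A w).map (starRingEnd ℂ)) z =
      (matHolPartial k A z).map (starRingEnd ℂ) := by
  ext i j
  simp only [matDzbar, Matrix.of_apply, Matrix.map_apply]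
  rw [dzbar_conj (hA i j).real, (hA i j).dz_eq]
  rfl

end MatrixCalculus

/-! ### Curvature of `2 Im T` in a holomorphic frame. -/

section LocalCurvature

open Matrix

variable {r : ℕ}

/-- The matrix `2 Im T` of a symmetric `T`, written as `-√-1 (T - T̄)`. -/
def twoIm (T : Matrix (Fin r) (Fin r) ℂ) : Matrix (Fin r) (Fin r) ℂ :=
  (-Complex.I) • T + Complex.I • T.map (starRingEnd ℂ)

variable {G J T : Cn r → Matrix (Fin r) (Fin r) ℂ} {z : Cn r}

protected lemma MatHolAt.twoIm (hT : MatHolAt T z) : MatDiffAt (fun w => twoIm (T w)) z :=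
  (hT.matDiffAt.smul _).add (hT.matDiffAt.conj.smul _)

lemma MatHolAt.matDz_twoIm (hT : MatHolAt T z) (k : Fin r) :
    matDz k (fun w => twoIm (T w)) z = (-Complex.I) • matHolPartial k T z := by
  unfold twoIm
  rw [matDz_add (hT.matDiffAt.smul _) (hT.matDiffAt.conj.smul _), matDz_smul _ hT.matDiffAt,
    matDz_smul _ hT.matDiffAt.conj, hT.matDz_conj, hT.matDz_eq]
  simp

lemma MatHolAt.matDzbar_twoIm (hT : MatHolAt T z) (k : Fin r) :
    matDzbar k (fun w => twoIm (T w)) z =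
      Complex.I • (matHolPartial k T z).map (starRingEnd ℂ) := by
  unfold twoIm
  rw [matDzbar_add (hT.matDiffAt.smul _) (hT.matDiffAt.conj.smul _), matDzbar_smul _ hT.matDiffAt,
    matDzbar_smul _ hT.matDiffAt.conj, hT.matDzbar_conj, hT.matDzbar_eq]
  simp

lemma isUnit_det_map_conj {J : Matrix (Fin r) (Fin r) ℂ} (hJ : IsUnit J.det) :
    IsUnit (J.map (starRingEnd ℂ)).det := by
  have := RingHom.map_det (starRingEnd ℂ) J
  rw [RingHom.mapMatrix_apply] at this
  rw [← this]
  exact hJ.map _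

/-- The curvature `-∂∂̄G + ∂G G⁻¹ ∂̄G` of a Hermitian form that in the holomorphic frame `J` becomes
`2 Im T` with `T` holomorphic. -/
lemma curvature_of_frame (hJ : MatHolAt J z) (hT : MatHolAt T z)
    (hG : ∀ᶠ w in 𝓝 z, G w = (J w)ᵀ * twoIm (T w) * (J w).map (starRingEnd ℂ))
    (hJdet : IsUnit (J z).det) (hHdet : IsUnit (twoIm (T z)).det) (k l : Fin r) :
    -matDz k (matDzbar l G) z + matDz k G z * (G z)⁻¹ * matDzbar l G z =
      (J z)ᵀ * ((-Complex.I) • matHolPartial k T z) * (twoIm (T z))⁻¹ *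
        (Complex.I • (matHolPartial l T z).map (starRingEnd ℂ)) * (J z).map (starRingEnd ℂ) := by
  -- Needed on a neighbourhood, since `∂_k` is applied to it below.
  have hbar : ∀ᶠ w in 𝓝 z, matDzbar l G w = (J w)ᵀ *
      (twoIm (T w) * (matHolPartial l J w).map (starRingEnd ℂ) +
        (Complex.I • (matHolPartial l T w).map (starRingEnd ℂ)) * (J w).map (starRingEnd ℂ)) := by
    filter_upwards [hJ.eventually, hT.eventually, hG.eventually_nhds] with w hJ hT hG
    rw [matDzbar_congr hG, matDzbar_mul (hJ.matDiffAt.transpose.mul hT.twoIm) hJ.matDiffAt.conj,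
      matDzbar_mul hJ.matDiffAt.transpose hT.twoIm, matDzbar_transpose, hJ.matDzbar_eq,
      hJ.matDzbar_conj, hT.matDzbar_twoIm]
    simp only [transpose_zero, zero_mul, zero_add, mul_add, Matrix.mul_assoc]
    rw [add_comm]
  have hJ' := hJ.matHolPartial l
  have hT' := hT.matHolPartial l
  have hz : matDz k G z = ((matHolPartial k J z)ᵀ * twoIm (T z) +
      (J z)ᵀ * ((-Complex.I) • matHolPartial k T z)) * (J z).map (starRingEnd ℂ) := by
    rw [matDz_congr hG, matDz_mul (hJ.matDiffAt.transpose.mul hT.twoIm) hJ.matDiffAt.conj,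
      matDz_mul hJ.matDiffAt.transpose hT.twoIm, matDz_transpose, hJ.matDz_eq,
      hJ.matDz_conj, hT.matDz_twoIm, mul_zero, add_zero]
  have hzz : matDz k (matDzbar l G) z = (matHolPartial k J z)ᵀ *
      (twoIm (T z) * (matHolPartial l J z).map (starRingEnd ℂ) +
        (Complex.I • (matHolPartial l T z).map (starRingEnd ℂ)) * (J z).map (starRingEnd ℂ)) +
      (J z)ᵀ * (((-Complex.I) • matHolPartial k T z) *
        (matHolPartial l J z).map (starRingEnd ℂ)) := by
    have d1 := hT.twoIm.mul hJ'.matDiffAt.conj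
    have d2 := (hT'.matDiffAt.conj.smul Complex.I).mul hJ.matDiffAt.conj
    rw [matDz_congr hbar, matDz_mul hJ.matDiffAt.transpose (d1.add d2), matDz_add d1 d2,
      matDz_mul hT.twoIm hJ'.matDiffAt.conj,
      matDz_mul (hT'.matDiffAt.conj.smul Complex.I) hJ.matDiffAt.conj,
      matDz_smul _ hT'.matDiffAt.conj, hT'.matDz_conj, hJ.matDz_conj, hJ'.matDz_conj,
      hT.matDz_twoIm, matDz_transpose, hJ.matDz_eq]
    simp
  have hJt : IsUnit (J z)ᵀ.det := by rwa [det_transpose]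
  have hJc := isUnit_det_map_conj hJdet
  rw [hzz, hz, hbar.self_of_nhds, hG.self_of_nhds, Matrix.mul_inv_rev, Matrix.mul_inv_rev]
  -- What remains is noncommutative algebra: `∂∂̄G = pHq + pbj' + jaq`, while `(pH + ja) H⁻¹ (Hq +
  -- bj')` has these three terms and `j a H⁻¹ b j'`, the only one free of derivatives of `J`.
  generalize (-Complex.I) • matHolPartial k T z = a
  generalize Complex.I • (matHolPartial l T z).map (starRingEnd ℂ) = b
  generalize (matHolPartial l J z).map (starRingEnd ℂ) = q
  generalize (matHolPartial k J z)ᵀ = p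
  generalize (J z).map (starRingEnd ℂ) = j' at *
  generalize (J z)ᵀ = j at *
  generalize twoIm (T z) = H at *
  have e1 : (p * H + j * a) * j' * (j'⁻¹ * (H⁻¹ * j⁻¹)) * (j * (H * q + b * j')) =
      (p * H + j * a) * (j' * j'⁻¹) * H⁻¹ * (j⁻¹ * j) * (H * q + b * j') := by
    simp only [Matrix.mul_assoc]
  rw [e1, mul_nonsing_inv _ hJc, nonsing_inv_mul _ hJt, Matrix.mul_one, Matrix.mul_one]
  have e2 : (p * H + j * a) * H⁻¹ * (H * q + b * j') =
      p * (H * H⁻¹) * H * q + p * (H * H⁻¹) * b * j' + j * a * (H⁻¹ * H) * q +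
        j * a * H⁻¹ * b * j' := by noncomm_ring
  rw [e2, mul_nonsing_inv _ hHdet, nonsing_inv_mul _ hHdet]
  noncomm_ring

end LocalCurvature

/-! ### Hermitian norms of cubic forms via Kronecker powers. -/

section CubicForms

open Matrix
open scoped Kronecker

variable {r : ℕ}

/-- The components of a cubic form as a vector. -/
def cubeVec (y : Fin r → Fin r → Fin r → ℂ) : Fin r × Fin r × Fin r → ℂ :=
  fun p => y p.1 p.2.1 p.2.2

/-- The third Kronecker power. -/
def cubeMat (K : Matrix (Fin r) (Fin r) ℂ) :
    Matrix (Fin r × Fin r × Fin r) (Fin r × Fin r × Fin r) ℂ := K ⊗ₖ (K ⊗ₖ K)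

/-- The Hermitian norm of a cubic form with respect to the inverse metric `K`. -/
def cubeNorm (K : Matrix (Fin r) (Fin r) ℂ) (y : Fin r → Fin r → Fin r → ℂ) : ℂ :=
  star (cubeVec y) ⬝ᵥ (cubeMat K *ᵥ cubeVec y)

lemma cubeNorm_eq_sum (K : Matrix (Fin r) (Fin r) ℂ) (y : Fin r → Fin r → Fin r → ℂ) :
    cubeNorm K y = ∑ i, ∑ j, ∑ k, ∑ l, ∑ m, ∑ n,
      y i j k * K l i * K m j * K n k * conj (y l m n) := by
  have : cubeNorm K y = ∑ q : Fin r × Fin r × Fin r, ∑ p : Fin r × Fin r × Fin r,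
      y q.1 q.2.1 q.2.2 * K p.1 q.1 * K p.2.1 q.2.1 * K p.2.2 q.2.2 *
        conj (y p.1 p.2.1 p.2.2) := by
    rw [Finset.sum_comm]
    simp only [cubeNorm, dotProduct, mulVec, Finset.mul_sum]
    refine Finset.sum_congr rfl fun p _ => Finset.sum_congr rfl fun q _ => ?_
    simp only [cubeVec, cubeMat, kroneckerMap_apply, Pi.star_apply, RCLike.star_def]
    ring
  rw [this]
  simp only [Fintype.sum_prod_type]

lemma cubeMat_mul (A B : Matrix (Fin r) (Fin r) ℂ) : cubeMat (A * B) = cubeMat A * cubeMat B := by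
  rw [cubeMat, cubeMat, cubeMat, mul_kronecker_mul, mul_kronecker_mul]

lemma cubeMat_conjTranspose (A : Matrix (Fin r) (Fin r) ℂ) : cubeMat Aᴴ = (cubeMat A)ᴴ := by
  rw [cubeMat, cubeMat, conjTranspose_kronecker, conjTranspose_kronecker]

lemma star_mulVec_dotProduct_mulVec {ι : Type*} [Fintype ι] (A K : Matrix ι ι ℂ) (v : ι → ℂ) :
    star (A *ᵥ v) ⬝ᵥ (K *ᵥ (A *ᵥ v)) = star v ⬝ᵥ ((Aᴴ * K * A) *ᵥ v) := by
  rw [star_mulVec, ← dotProduct_mulVec, mulVec_mulVec, mulVec_mulVec, Matrix.mul_assoc]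

/-- The pull-back of a cubic form along the linear map with matrix `J`. -/
def cubePull (J : Matrix (Fin r) (Fin r) ℂ) (y : Fin r → Fin r → Fin r → ℂ) :
    Fin r → Fin r → Fin r → ℂ :=
  fun i j k => ∑ a, ∑ b, ∑ c, y a b c * J a i * J b j * J c k

lemma cubeVec_cubePull (J : Matrix (Fin r) (Fin r) ℂ) (y : Fin r → Fin r → Fin r → ℂ) :
    cubeVec (cubePull J y) = cubeMat Jᵀ *ᵥ cubeVec y := by
  ext p
  simp only [cubeVec, cubePull, cubeMat, mulVec, dotProduct, Fintype.sum_prod_type,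
    kroneckerMap_apply, transpose_apply]
  refine Finset.sum_congr rfl fun a _ => Finset.sum_congr rfl fun b _ =>
    Finset.sum_congr rfl fun c _ => by ring

lemma cubePull_cubePull (J N : Matrix (Fin r) (Fin r) ℂ) (y : Fin r → Fin r → Fin r → ℂ) :
    cubePull J (cubePull N y) = cubePull (N * J) y := by
  have h : cubeVec (cubePull J (cubePull N y)) = cubeVec (cubePull (N * J) y) := by
    rw [cubeVec_cubePull, cubeVec_cubePull, cubeVec_cubePull, mulVec_mulVec, ← cubeMat_mul,
      transpose_mul]
  funext i j k
  exact congrFun h (i, j, k)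

lemma cubePull_zero (J : Matrix (Fin r) (Fin r) ℂ) :
    cubePull J (fun _ _ _ => 0) = fun _ _ _ => 0 := by
  funext i j k
  simp [cubePull]

/-- Moves the Jacobian from the cubic form to the inverse metric, where `frame_inv` cancels it; this
gives the coordinate invariance of `‖Y‖²`. -/
lemma cubeNorm_cubePull (J K : Matrix (Fin r) (Fin r) ℂ) (y : Fin r → Fin r → Fin r → ℂ) :
    cubeNorm K (cubePull J y) = cubeNorm (J.map (starRingEnd ℂ) * K * Jᵀ) y := by
  have hJ : J.map (starRingEnd ℂ) = Jᵀᴴ := rfl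
  rw [cubeNorm, cubeVec_cubePull, star_mulVec_dotProduct_mulVec, ← cubeMat_conjTranspose,
    ← cubeMat_mul, ← cubeMat_mul, hJ, cubeNorm]

lemma cubeNorm_nonneg {K : Matrix (Fin r) (Fin r) ℂ} (hK : K.PosSemidef)
    (y : Fin r → Fin r → Fin r → ℂ) : 0 ≤ cubeNorm K y :=
  (hK.kronecker (hK.kronecker hK)).dotProduct_mulVec_nonneg _

lemma eq_zero_of_cubeNorm_eq_zero {K : Matrix (Fin r) (Fin r) ℂ} (hK : K.PosDef)
    {y : Fin r → Fin r → Fin r → ℂ} (h : cubeNorm K y = 0) (i j k : Fin r) : y i j k = 0 := by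
  by_contra hne
  have hy : cubeVec y ≠ 0 := fun h0 => hne (congrFun h0 (i, j, k))
  exact ((hK.kronecker (hK.kronecker hK)).dotProduct_mulVec_pos hy).ne' h

/-- Telescoping, one tensor factor at a time, writes `K⊗K⊗K - L⊗L⊗L` as a sum of three Kronecker
products of positive semidefinite matrices. -/
lemma cubeNorm_mono {K L : Matrix (Fin r) (Fin r) ℂ} (hK : K.PosSemidef) (hL : L.PosSemidef)
    (hKL : (K - L).PosSemidef) (y : Fin r → Fin r → Fin r → ℂ) : cubeNorm L y ≤ cubeNorm K y := by
  have hd : (cubeMat K - cubeMat L).PosSemidef := by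
    have : cubeMat K - cubeMat L =
        (K - L) ⊗ₖ (K ⊗ₖ K) + (L ⊗ₖ ((K - L) ⊗ₖ K) + L ⊗ₖ (L ⊗ₖ (K - L))) := by
      ext p q
      simp only [cubeMat, kroneckerMap_apply, Matrix.sub_apply, Matrix.add_apply]
      ring
    rw [this]
    exact (hKL.kronecker (hK.kronecker hK)).add
      ((hL.kronecker (hKL.kronecker hK)).add (hL.kronecker (hL.kronecker hKL)))
  have := hd.dotProduct_mulVec_nonneg (cubeVec y)
  rw [sub_mulVec, dotProduct_sub] at this
  exact sub_nonneg.1 this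

/-- When `A` and `y` depend holomorphically on a point, this exhibits the norm as a sum of squared
moduli of holomorphic functions. -/
lemma cubeNorm_gram (A : Matrix (Fin r) (Fin r) ℂ) (y : Fin r → Fin r → Fin r → ℂ) :
    cubeNorm (Aᴴ * A) y =
      ∑ p, (cubeMat A *ᵥ cubeVec y) p * conj ((cubeMat A *ᵥ cubeVec y) p) := by
  have := star_mulVec_dotProduct_mulVec (cubeMat A) 1 (cubeVec y)
  rw [Matrix.one_mulVec, Matrix.mul_one, ← cubeMat_conjTranspose, ← cubeMat_mul] at this
  rw [cubeNorm, ← this, dotProduct]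
  exact Finset.sum_congr rfl fun p _ => mul_comm _ _

end CubicForms

/-! ### Order reversal and smoothness of matrix inversion. -/

section InverseOrder

open Matrix

variable {r : ℕ}

/-- With `E = P - H`, the difference equals `P⁻¹ (E + E H⁻¹ Eᴴ) P⁻¹ᴴ`, which is visibly positive
semidefinite. -/
lemma posSemidef_inv_sub_inv {H P : Matrix (Fin r) (Fin r) ℂ} (hH : H.PosDef)
    (hE : (P - H).PosSemidef) : (H⁻¹ - P⁻¹).PosSemidef := by
  have hP : P.PosDef := by simpa using hH.add_posSemidef hE
  have hHu := (isUnit_iff_isUnit_det _).1 hH.isUnit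
  have hPu := (isUnit_iff_isUnit_det _).1 hP.isUnit
  have key : H⁻¹ - P⁻¹ = P⁻¹ * ((P - H) + (P - H) * H⁻¹ * (P - H)ᴴ) * P⁻¹ᴴ := by
    have h1 : P⁻¹ᴴ = P⁻¹ := hP.inv.isHermitian
    have h2 : (P - H)ᴴ = P - H := hE.isHermitian
    have h3 : (P - H) + (P - H) * H⁻¹ * (P - H) = (P - H) * H⁻¹ * P := by
      have : (P - H) * H⁻¹ * (P - H) = (P - H) * H⁻¹ * P - (P - H) * (H⁻¹ * H) := by noncomm_ring
      rw [this, nonsing_inv_mul _ hHu]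
      simp
    rw [h1, h2, h3]
    have h4 : P⁻¹ * ((P - H) * H⁻¹ * P) * P⁻¹ =
        (P⁻¹ * P) * H⁻¹ * (P * P⁻¹) - P⁻¹ * (H * H⁻¹) * (P * P⁻¹) := by noncomm_ring
    rw [h4, nonsing_inv_mul _ hPu, mul_nonsing_inv _ hPu, mul_nonsing_inv _ hHu]
    simp
  rw [key]
  exact (hE.add (hH.inv.posSemidef.mul_mul_conjTranspose_same _)).mul_mul_conjTranspose_same _

lemma contDiffAt_matrix_det {𝕜 E : Type*} [NontriviallyNormedField 𝕜] [NormedAlgebra 𝕜 ℂ]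
    [NormedAddCommGroup E] [NormedSpace 𝕜 E] {n : WithTop ℕ∞} {A : E → Matrix (Fin r) (Fin r) ℂ}
    {z : E} (hA : ∀ i j, ContDiffAt 𝕜 n (fun w => A w i j) z) :
    ContDiffAt 𝕜 n (fun w => (A w).det) z := by
  simp only [Matrix.det_apply]
  refine ContDiffAt.sum fun σ _ => ?_
  have : ContDiffAt 𝕜 n (fun w => ∏ i, A w (σ i) i) z := contDiffAt_prod fun i _ => hA _ _
  have h2 := (contDiffAt_const (c := ((Equiv.Perm.sign σ : ℤ) : ℂ))).mul this
  refine h2.congr_of_eventuallyEq (Filter.Eventually.of_forall fun w => ?_)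
  simp [Units.smul_def]

/-- Cramer's rule. The scalar field is left free: `ℝ` serves the smoothness of the inverse metric,
`ℂ` the holomorphy of `Q⁻¹`. -/
lemma contDiffAt_matrix_inv {𝕜 E : Type*} [NontriviallyNormedField 𝕜] [NormedAlgebra 𝕜 ℂ]
    [NormedAddCommGroup E] [NormedSpace 𝕜 E] {n : WithTop ℕ∞} {A : E → Matrix (Fin r) (Fin r) ℂ}
    {z : E} (hA : ∀ i j, ContDiffAt 𝕜 n (fun w => A w i j) z) (hdet : IsUnit (A z).det)
    (i j : Fin r) : ContDiffAt 𝕜 n (fun w => (A w)⁻¹ i j) z := by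
  have h1 := (contDiffAt_matrix_det hA).inv hdet.ne_zero
  have h2 : ContDiffAt 𝕜 n (fun w => (A w).adjugate i j) z := by
    simp only [Matrix.adjugate_apply]
    refine contDiffAt_matrix_det fun a b => ?_
    by_cases h : a = j
    · subst h
      simpa using contDiffAt_const
    · simpa [Matrix.updateRow_apply, h] using hA a b
  refine (h1.mul h2).congr_of_eventuallyEq (Filter.Eventually.of_forall fun w => ?_)
  simp [Matrix.inv_def]

end InverseOrder

/-! ### The Levi form, at local minima and on sums of squared moduli. -/

section LeviForm

variable {r : ℕ} {f g : Cn r → ℂ} {z : Cn r}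

/-- The complex Hessian `∂_i ∂_{j̄} f v^i v̄^j`. -/
def levi (f : Cn r → ℂ) (z v : Cn r) : ℂ :=
  ∑ i, ∑ j, dz i (dzbar j f) z * v i * conj (v j)

lemma sum_single_re_im (v : Cn r) :
    v = ∑ j, ((v j).re • (Pi.single j 1 : Cn r) + (v j).im • (Pi.single j Complex.I : Cn r)) := by
  ext i
  have hi : ∀ j, ((v j).re • (Pi.single j 1 : Cn r) + (v j).im • (Pi.single j Complex.I : Cn r)) i =
      if i = j then v j else 0 := fun j => by
    by_cases h : i = j
    · subst h
      simp [Complex.re_add_im]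
    · simp [h]
  simp only [Finset.sum_apply, hi]
  simp

lemma sum_single_I_re_im (v : Cn r) :
    Complex.I • v =
      ∑ j, ((v j).re • (Pi.single j Complex.I : Cn r) - (v j).im • (Pi.single j 1 : Cn r)) := by
  rw [sum_single_re_im (Complex.I • v)]
  refine Finset.sum_congr rfl fun j _ => ?_
  simp
  abel

lemma sum_dzbar_mul_conj (f : Cn r → ℂ) (w v : Cn r) :
    ∑ j, dzbar j f w * conj (v j) =
      (fderiv ℝ f w v + Complex.I * fderiv ℝ f w (Complex.I • v)) / 2 := by
  rw [sum_single_I_re_im v, congrArg (fderiv ℝ f w) (sum_single_re_im v)]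
  simp only [map_sum, map_add, map_sub, map_smul, Finset.mul_sum]
  rw [← Finset.sum_add_distrib, Finset.sum_div]
  refine Finset.sum_congr rfl fun j _ => ?_
  have hc : conj (v j) = (v j).re - (v j).im * Complex.I := by
    apply Complex.ext <;> simp
  simp only [dzbar, hc, Complex.real_smul]
  linear_combination (-(v j).im * (fderiv ℝ f w) (Pi.single j Complex.I) / 2) * Complex.I_sq

lemma sum_dz_mul (f : Cn r → ℂ) (w v : Cn r) :
    ∑ i, dz i f w * v i =
      (fderiv ℝ f w v - Complex.I * fderiv ℝ f w (Complex.I • v)) / 2 := by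
  rw [sum_single_I_re_im v, congrArg (fderiv ℝ f w) (sum_single_re_im v)]
  simp only [map_sum, map_add, map_sub, map_smul, Finset.mul_sum]
  rw [← Finset.sum_sub_distrib, Finset.sum_div]
  refine Finset.sum_congr rfl fun j _ => ?_
  have hc : v j = (v j).re + (v j).im * Complex.I := (Complex.re_add_im _).symm
  conv_lhs => rw [hc]
  simp only [dz, Complex.real_smul]
  linear_combination (-(v j).im * (fderiv ℝ f w) (Pi.single j Complex.I) / 2) * Complex.I_sq

lemma differentiableAt_fderiv (hf : ContDiffAt ℝ ∞ f z) : DifferentiableAt ℝ (fderiv ℝ f) z :=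
  (hf.fderiv_right (m := ∞) (by simp)).differentiableAt (by simp)

lemma hasFDerivAt_fderiv_apply (hf : ContDiffAt ℝ ∞ f z) (v : Cn r) :
    HasFDerivAt (fun w => fderiv ℝ f w v) ((fderiv ℝ (fderiv ℝ f) z).flip v) z := by
  simpa using (differentiableAt_fderiv hf).hasFDerivAt.clm_apply (hasFDerivAt_const v z)

lemma differentiableAt_dzbar (hf : ContDiffAt ℝ ∞ f z) (j : Fin r) :
    DifferentiableAt ℝ (dzbar j f) z := by
  have h := fun v => (hasFDerivAt_fderiv_apply hf v).differentiableAt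
  have h2 := ((h (Pi.single j 1)).add ((h (Pi.single j Complex.I)).const_mul Complex.I)).mul_const
    (2 : ℂ)⁻¹
  exact h2.congr_of_eventuallyEq (Filter.Eventually.of_forall fun w => div_eq_mul_inv _ _)

/-- The cross terms `±i D²f(v, iv)` cancel by symmetry of the real second derivative. This form lets
the real second-order condition at a minimum apply. -/
lemma levi_eq (hf : ContDiffAt ℝ ∞ f z) (v : Cn r) :
    levi f z v = (fderiv ℝ (fderiv ℝ f) z v v +
      fderiv ℝ (fderiv ℝ f) z (Complex.I • v) (Complex.I • v)) / 4 := by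
  have h1 : levi f z v = ∑ i, dz i (fun w => ∑ j, dzbar j f w * conj (v j)) z * v i := by
    refine Finset.sum_congr rfl fun i _ => ?_
    have hd := differentiableAt_dzbar hf
    rw [dz_sum (F := fun j w => dzbar j f w * conj (v j)) fun j _ => (hd j).mul_const _,
      Finset.sum_mul]
    refine Finset.sum_congr rfl fun j _ => ?_
    rw [dz_mul (hd j) (differentiableAt_const _), dz_const]
    ring
  have h2 : HasFDerivAt (fun w => (fderiv ℝ f w v + Complex.I * fderiv ℝ f w (Complex.I • v)) / 2)
      ((2 : ℂ)⁻¹ • ((fderiv ℝ (fderiv ℝ f) z).flip v +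
        Complex.I • (fderiv ℝ (fderiv ℝ f) z).flip (Complex.I • v))) z := by
    have := ((hasFDerivAt_fderiv_apply hf v).add
      ((hasFDerivAt_fderiv_apply hf (Complex.I • v)).const_mul Complex.I)).const_mul (2 : ℂ)⁻¹
    refine this.congr_of_eventuallyEq (Filter.Eventually.of_forall fun w => ?_)
    simp only [Pi.add_apply]
    ring
  have hsymm := (hf.of_le (m := 2) ENat.LEInfty.out).isSymmSndFDerivAt (by simp)
    v (Complex.I • v)
  simp only [h1, sum_dzbar_mul_conj, sum_dz_mul, h2.fderiv, add_apply, smul_apply,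
    ContinuousLinearMap.flip_apply, smul_eq_mul, hsymm]
  linear_combination (-(1 / 4) * fderiv ℝ (fderiv ℝ f) z (Complex.I • v) (Complex.I • v)) *
    Complex.I_sq

/-- Restrict to the line in direction `u`. A negative second derivative would make the minimum also
a local maximum, so the restriction would be locally constant, with second derivative zero. -/
lemma fderiv_fderiv_nonneg_of_isLocalMin {h : Cn r → ℝ} (hh : ContDiffAt ℝ ∞ h z)
    (hmin : IsLocalMin h z) (u : Cn r) : 0 ≤ fderiv ℝ (fderiv ℝ h) z u u := by
  have hline : ∀ t : ℝ, HasDerivAt (fun t : ℝ => z + t • u) u t := fun t => by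
    simpa using ((hasDerivAt_id t).smul_const u).const_add z
  have hline0 : Filter.Tendsto (fun t : ℝ => z + t • u) (𝓝 0) (𝓝 z) := by
    simpa using (hline 0).continuousAt.tendsto
  have hdiff : ∀ᶠ w in 𝓝 z, DifferentiableAt ℝ h w :=
    ((hh.of_le (m := 1) (by exact_mod_cast le_top)).eventually (by simp)).mono
      fun _ h => h.differentiableAt one_ne_zero
  set k : ℝ → ℝ := fun t => h (z + t • u) with hk
  have hk1 : deriv k =ᶠ[𝓝 0] fun t => fderiv ℝ h (z + t • u) u := by
    filter_upwards [hline0.eventually hdiff] with t ht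
    exact (ht.hasFDerivAt.comp_hasDerivAt t (hline t)).deriv
  have hd2 : DifferentiableAt ℝ (fderiv ℝ h) z :=
    (hh.fderiv_right (m := ∞) (by simp)).differentiableAt (by simp)
  have hk2 : deriv (deriv k) 0 = fderiv ℝ (fderiv ℝ h) z u u := by
    rw [hk1.deriv_eq]
    have h1 : HasFDerivAt (fun w => fderiv ℝ h w u) ((fderiv ℝ (fderiv ℝ h) z).flip u)
        (z + (0 : ℝ) • u) := by
      simpa using hd2.hasFDerivAt.clm_apply (hasFDerivAt_const u z)
    exact (h1.comp_hasDerivAt 0 (hline 0)).deriv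
  have hkmin : IsLocalMin k 0 := by
    filter_upwards [hline0.eventually hmin] with t ht
    simpa [hk] using ht
  by_contra hneg
  rw [not_le, ← hk2] at hneg
  have hcont : ContinuousAt k 0 := by
    have : ContinuousAt h (z + (0 : ℝ) • u) := by simpa using hh.continuousAt
    exact this.comp (f := fun t : ℝ => z + t • u) (hline 0).continuousAt
  have hkmax := isLocalMax_of_deriv_deriv_neg hneg hkmin.deriv_eq_zero hcont
  have hconst : k =ᶠ[𝓝 0] fun _ => k 0 := by
    filter_upwards [hkmin, hkmax] with t h1 h2 using le_antisymm h2 h1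
  have : deriv (deriv k) 0 = 0 := by
    rw [hconst.deriv.deriv_eq]
    simp
  exact hneg.ne this

lemma contDiffAt_ofReal_comp {h : Cn r → ℝ} (hh : ContDiffAt ℝ ∞ h z) :
    ContDiffAt ℝ ∞ (fun w => (h w : ℂ)) z :=
  Complex.ofRealCLM.contDiff.contDiffAt.comp z hh

lemma fderiv_fderiv_ofReal {h : Cn r → ℝ} (hh : ContDiffAt ℝ ∞ h z) (u v : Cn r) :
    fderiv ℝ (fderiv ℝ fun w => (h w : ℂ)) z u v = (fderiv ℝ (fderiv ℝ h) z u v : ℝ) := by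
  have hdiff : ∀ᶠ w in 𝓝 z, DifferentiableAt ℝ h w :=
    ((hh.of_le (m := 1) (by exact_mod_cast le_top)).eventually (by simp)).mono
      fun _ h => h.differentiableAt one_ne_zero
  have hd2 : DifferentiableAt ℝ (fderiv ℝ h) z :=
    (hh.fderiv_right (m := ∞) (by simp)).differentiableAt (by simp)
  have h1 : fderiv ℝ (fun w => (h w : ℂ)) =ᶠ[𝓝 z]
      fun w => Complex.ofRealCLM.comp (fderiv ℝ h w) := by
    filter_upwards [hdiff] with w hw
    exact (Complex.ofRealCLM.hasFDerivAt.comp w hw.hasFDerivAt).fderiv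
  rw [h1.fderiv_eq]
  have h2 := (hasFDerivAt_const Complex.ofRealCLM z).clm_comp hd2.hasFDerivAt
  rw [h2.fderiv]
  simp

lemma levi_nonneg_of_isLocalMin {h : Cn r → ℝ} (hh : ContDiffAt ℝ ∞ h z)
    (hmin : IsLocalMin h z) (v : Cn r) : 0 ≤ levi (fun w => (h w : ℂ)) z v := by
  rw [levi_eq (contDiffAt_ofReal_comp hh), fderiv_fderiv_ofReal hh, fderiv_fderiv_ofReal hh]
  have h1 := fderiv_fderiv_nonneg_of_isLocalMin hh hmin v
  have h2 := fderiv_fderiv_nonneg_of_isLocalMin hh hmin (Complex.I • v)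
  have : (0 : ℝ) ≤ (fderiv ℝ (fderiv ℝ h) z v v +
      fderiv ℝ (fderiv ℝ h) z (Complex.I • v) (Complex.I • v)) / 4 := by positivity
  exact_mod_cast this

lemma levi_congr (h : f =ᶠ[𝓝 z] g) (v : Cn r) : levi f z v = levi g z v := by
  refine Finset.sum_congr rfl fun i _ => Finset.sum_congr rfl fun j _ => ?_
  have : dzbar j f =ᶠ[𝓝 z] dzbar j g := h.eventuallyEq_nhds.mono fun w hw => dzbar_congr hw j
  rw [dz_congr this]

lemma levi_add (hf : ContDiffAt ℝ ∞ f z) (hg : ContDiffAt ℝ ∞ g z) (v : Cn r) :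
    levi (fun w => f w + g w) z v = levi f z v + levi g z v := by
  have hev : ∀ {f : Cn r → ℂ}, ContDiffAt ℝ ∞ f z → ∀ᶠ w in 𝓝 z, DifferentiableAt ℝ f w :=
    fun hf => ((hf.of_le (m := 1) (by exact_mod_cast le_top)).eventually (by simp)).mono
      fun _ h => h.differentiableAt one_ne_zero
  simp only [levi]
  rw [← Finset.sum_add_distrib]
  refine Finset.sum_congr rfl fun i _ => ?_
  rw [← Finset.sum_add_distrib]
  refine Finset.sum_congr rfl fun j _ => ?_
  have : dzbar j (fun w => f w + g w) =ᶠ[𝓝 z] fun w => dzbar j f w + dzbar j g w := by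
    filter_upwards [hev hf, hev hg] with w h1 h2 using dzbar_add h1 h2 j
  rw [dz_congr this, dz_add (differentiableAt_dzbar hf j) (differentiableAt_dzbar hg j)]
  ring

/-- For holomorphic `q_p` the Levi form is `∑_p |∑_i ∂_i q_p v^i|²`. -/
lemma levi_sum_normSq_nonneg {ι : Type*} [Fintype ι] {q : ι → Cn r → ℂ}
    (hq : ∀ p, HolAt (q p) z) (v : Cn r) :
    0 ≤ levi (fun w => ∑ p, q p w * conj (q p w)) z v := by
  have hdz : ∀ i j, dz i (dzbar j fun w => ∑ p, q p w * conj (q p w)) z =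
      ∑ p, holPartial i (q p) z * conj (holPartial j (q p) z) := by
    intro i j
    have h1 : (dzbar j fun w => ∑ p, q p w * conj (q p w)) =ᶠ[𝓝 z]
        fun w => ∑ p, q p w * conj (holPartial j (q p) w) := by
      filter_upwards [Filter.eventually_all.2 fun p => (hq p).eventually] with w hw
      rw [dzbar_sum (F := fun p w => q p w * conj (q p w))
        fun p _ => (hw p).real.mul (differentiableAt_conj (hw p).real)]
      refine Finset.sum_congr rfl fun p _ => ?_
      rw [dzbar_mul (hw p).real (differentiableAt_conj (hw p).real), (hw p).dzbar_eq,
        dzbar_conj (hw p).real, (hw p).dz_eq]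
      ring
    have hp := fun p => ((hq p).holPartial j)
    rw [dz_congr h1, dz_sum (F := fun p w => q p w * conj (holPartial j (q p) w))
      fun p _ => (hq p).real.mul (differentiableAt_conj (hp p).real)]
    refine Finset.sum_congr rfl fun p _ => ?_
    rw [dz_mul (hq p).real (differentiableAt_conj (hp p).real), (hq p).dz_eq,
      dz_conj (hp p).real, (hp p).dzbar_eq]
    simp
  have : levi (fun w => ∑ p, q p w * conj (q p w)) z v =
      ∑ p, (∑ i, holPartial i (q p) z * v i) * conj (∑ i, holPartial i (q p) z * v i) := by
    simp only [levi, hdz, map_sum, Finset.sum_mul_sum, map_mul]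
    conv_rhs => rw [Finset.sum_comm]
    refine Finset.sum_congr rfl fun i _ => ?_
    conv_rhs => rw [Finset.sum_comm]
    refine Finset.sum_congr rfl fun j _ => ?_
    rw [Finset.sum_mul, Finset.sum_mul]
    exact Finset.sum_congr rfl fun p _ => by ring
  rw [this]
  refine Finset.sum_nonneg fun p _ => ?_
  rw [Complex.mul_conj]
  exact_mod_cast Complex.normSq_nonneg _

end LeviForm

/-! ### Plurisubharmonicity of the norm of a holomorphic cubic form. -/

section CubicNormPlurisubharmonic

open Matrix

variable {r : ℕ} {T : Cn r → Matrix (Fin r) (Fin r) ℂ} {z : Cn r}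

lemma twoIm_eq_of_transpose {T : Matrix (Fin r) (Fin r) ℂ} (hT : Tᵀ = T) :
    twoIm T = (-Complex.I) • T + Complex.I • Tᴴ := by
  have : T.map (starRingEnd ℂ) = Tᴴ := by
    conv_rhs => rw [← hT]
    rfl
  rw [twoIm, this]

/-- The comparison `2 Im T ≤ Q (2 Im T₀)⁻¹ Qᴴ` with `Q = -√-1 (T - T̄₀)`, an equality at `T₀`. -/
lemma twoIm_comparison {T T₀ : Matrix (Fin r) (Fin r) ℂ} (hT : Tᵀ = T) (hT₀ : T₀ᵀ = T₀)
    (hH₀ : (twoIm T₀).PosDef) :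
    ((twoIm T₀ + (-Complex.I) • (T - T₀)) * (twoIm T₀)⁻¹ *
      (twoIm T₀ + (-Complex.I) • (T - T₀))ᴴ - twoIm T).PosSemidef := by
  have hu := (isUnit_iff_isUnit_det _).1 hH₀.isUnit
  have key : (twoIm T₀ + (-Complex.I) • (T - T₀)) * (twoIm T₀)⁻¹ *
      (twoIm T₀ + (-Complex.I) • (T - T₀))ᴴ - twoIm T =
      ((-Complex.I) • (T - T₀)) * (twoIm T₀)⁻¹ * ((-Complex.I) • (T - T₀))ᴴ := by
    -- With `D = -i(T - T₀)` this reads `H = H₀ + D + Dᴴ`; symmetry of `T` and `T₀` turns entrywise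
    -- conjugates into adjoints. Since `(H₀ + D) H₀⁻¹ (H₀ + Dᴴ) = H₀ + D + Dᴴ + D H₀⁻¹ Dᴴ`, only the
    -- last term survives.
    have h1 : twoIm T = twoIm T₀ + (-Complex.I) • (T - T₀) + ((-Complex.I) • (T - T₀))ᴴ := by
      rw [twoIm_eq_of_transpose hT, twoIm_eq_of_transpose hT₀, conjTranspose_smul,
        conjTranspose_sub]
      simp only [star_neg, RCLike.star_def, Complex.conj_I, neg_neg, smul_sub]
      module
    rw [h1, conjTranspose_add, hH₀.isHermitian.eq]
    generalize ((-Complex.I) • (T - T₀)) = D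
    generalize twoIm T₀ = H at *
    have : (H + D) * H⁻¹ * (H + Dᴴ) =
        (H * H⁻¹) * H + (H * H⁻¹) * Dᴴ + D * (H⁻¹ * H) + D * H⁻¹ * Dᴴ := by noncomm_ring
    rw [this, mul_nonsing_inv _ hu, nonsing_inv_mul _ hu]
    noncomm_ring
  rw [key]
  exact hH₀.inv.posSemidef.mul_mul_conjTranspose_same _

lemma contDiffAt_cubeNorm {K : Cn r → Matrix (Fin r) (Fin r) ℂ}
    {y : Cn r → Fin r → Fin r → Fin r → ℂ} (hK : ∀ i j, ContDiffAt ℝ ∞ (fun w => K w i j) z)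
    (hy : ∀ i j k, HolAt (fun w => y w i j k) z) :
    ContDiffAt ℝ ∞ (fun w => cubeNorm (K w) (y w)) z := by
  simp only [cubeNorm_eq_sum]
  refine ContDiffAt.sum fun i _ => ContDiffAt.sum fun j _ => ContDiffAt.sum fun k _ =>
    ContDiffAt.sum fun l _ => ContDiffAt.sum fun m _ => ContDiffAt.sum fun n _ => ?_
  exact ((((hy i j k).contDiffAt_real.mul (hK l i)).mul (hK m j)).mul (hK n k)).mul
    (Complex.conjCLE.toContinuousLinearMap.contDiff.contDiffAt.comp z (hy l m n).contDiffAt_real)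

lemma MatHolAt.contDiffAt_twoIm (hT : MatHolAt T z) (i j : Fin r) :
    ContDiffAt ℝ ∞ (fun w => twoIm (T w) i j) z := by
  simp only [twoIm, Matrix.add_apply, Matrix.smul_apply, Matrix.map_apply, smul_eq_mul]
  exact (contDiffAt_const.mul (hT i j).contDiffAt_real).add (contDiffAt_const.mul
    (Complex.conjCLE.toContinuousLinearMap.contDiff.contDiffAt.comp z (hT i j).contDiffAt_real))

/-- The norm of a holomorphic cubic form with respect to the metric `2 Im T`, with `T` holomorphic and
symmetric, is smooth and has a non-negative complex Hessian. -/
lemma contDiffAt_and_levi_nonneg {f : Cn r → ℝ} {y : Cn r → Fin r → Fin r → Fin r → ℂ}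
    (hT : MatHolAt T z) (hTs : ∀ᶠ w in 𝓝 z, (T w)ᵀ = T w)
    (hH : ∀ᶠ w in 𝓝 z, (twoIm (T w)).PosDef) (hy : ∀ i j k, HolAt (fun w => y w i j k) z)
    (hf : ∀ᶠ w in 𝓝 z, (f w : ℂ) = cubeNorm (twoIm (T w))⁻¹ (y w)) :
    ContDiffAt ℝ ∞ f z ∧ ∀ v, 0 ≤ levi (fun w => (f w : ℂ)) z v := by
  have hHz := hH.self_of_nhds
  have hu := (isUnit_iff_isUnit_det _).1 hHz.isUnit
  have hfc : ContDiffAt ℝ ∞ (fun w => (f w : ℂ)) z :=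
    (contDiffAt_cubeNorm (contDiffAt_matrix_inv hT.contDiffAt_twoIm hu) hy).congr_of_eventuallyEq hf
  have hfr : ContDiffAt ℝ ∞ f z := by
    have := Complex.reCLM.contDiff.contDiffAt.comp z hfc
    simpa [Function.comp_def] using this
  refine ⟨hfr, fun v => ?_⟩
  -- This square root makes the comparison metric `(Q H₀⁻¹ Qᴴ)⁻¹` the Gram matrix of the holomorphic
  -- `A = B Q⁻¹`.
  obtain ⟨B, hB⟩ : ∃ B : Matrix (Fin r) (Fin r) ℂ, twoIm (T z) = Bᴴ * B := by
    open scoped MatrixOrder in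
    exact CStarAlgebra.nonneg_iff_eq_star_mul_self.1 (nonneg_iff_posSemidef.2 hHz.posSemidef)
  -- `Q w = -i(T w - T̄ z)`: holomorphic in `w`, as the conjugate part is frozen at `z`.
  set Q : Cn r → Matrix (Fin r) (Fin r) ℂ := fun w => twoIm (T z) + (-Complex.I) • (T w - T z)
    with hQ
  have hQz : Q z = twoIm (T z) := by simp [hQ]
  have hQhol : MatHolAt Q z := fun i j =>
    (holAt_const _).add ((holAt_const _).mul ((hT i j).sub (holAt_const _)))
  have hQu : IsUnit (Q z).det := by rwa [hQz]
  have hQinv : MatHolAt (fun w => (Q w)⁻¹) z := fun i j =>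
    holAt_of_contDiffAt (contDiffAt_matrix_inv (fun i j => (hQhol i j).contDiffAt) hQu i j)
  set A : Cn r → Matrix (Fin r) (Fin r) ℂ := fun w => B * (Q w)⁻¹ with hA
  have hAhol : MatHolAt A z := fun i j => by
    simp only [hA, Matrix.mul_apply]
    exact HolAt.sum fun l _ => (holAt_const _).mul (hQinv l j)
  set q : (Fin r × Fin r × Fin r) → Cn r → ℂ := fun p w => (cubeMat (A w) *ᵥ cubeVec (y w)) p
    with hq
  have hqhol : ∀ p, HolAt (q p) z := fun p => by
    simp only [hq, mulVec, dotProduct, cubeMat, kroneckerMap_apply, cubeVec]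
    exact HolAt.sum fun s _ =>
      ((hAhol _ _).mul ((hAhol _ _).mul (hAhol _ _))).mul (hy _ _ _)
  have hsum : ∀ w, ∑ p, q p w * conj (q p w) = ((∑ p, Complex.normSq (q p w) : ℝ) : ℂ) := fun w => by
    simp [Complex.mul_conj]
  have hgram : ∀ w, cubeNorm ((A w)ᴴ * A w) (y w) = ((∑ p, Complex.normSq (q p w) : ℝ) : ℂ) :=
    fun w => by rw [cubeNorm_gram, ← hsum]
  have hAA : ∀ w, (A w)ᴴ * A w = (Q w * (twoIm (T z))⁻¹ * (Q w)ᴴ)⁻¹ := fun w => by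
    rw [Matrix.mul_inv_rev, Matrix.mul_inv_rev, nonsing_inv_nonsing_inv _ hu, hB, hA,
      conjTranspose_mul, conjTranspose_nonsing_inv]
    simp only [Matrix.mul_assoc]
  have hsumc : ContDiffAt ℝ ∞ (fun w => ∑ p, q p w * conj (q p w)) z :=
    ContDiffAt.sum fun p _ => (hqhol p).contDiffAt_real.mul
      (Complex.conjCLE.toContinuousLinearMap.contDiff.contDiffAt.comp z (hqhol p).contDiffAt_real)
  have hsumr : ContDiffAt ℝ ∞ (fun w => ∑ p, Complex.normSq (q p w)) z := by
    have := Complex.reCLM.contDiff.contDiffAt.comp z hsumc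
    simpa [Function.comp_def, Complex.mul_conj] using this
  set h : Cn r → ℝ := fun w => f w - ∑ p, Complex.normSq (q p w) with hh
  have hhc : ContDiffAt ℝ ∞ h z := hfr.sub hsumr
  have hh0 : h z = 0 := by
    have h1 : (A z)ᴴ * A z = (twoIm (T z))⁻¹ := by
      rw [hAA, hQz, hHz.isHermitian.eq, mul_nonsing_inv _ hu, Matrix.one_mul]
    have h2 : (f z : ℂ) = ((∑ p, Complex.normSq (q p z) : ℝ) : ℂ) := by
      rw [hf.self_of_nhds, ← hgram, h1]
    simp only [hh, sub_eq_zero]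
    exact_mod_cast h2
  -- Inverting `twoIm_comparison` gives `AᴴA ≤ H⁻¹` near `z`; monotonicity of the cubic norm then
  -- gives `h ≥ 0 = h z`.
  have hmin : IsLocalMin h z := by
    filter_upwards [hf, hH, hTs] with w hfw hHw hTw
    rw [hh0]
    have hcmp := twoIm_comparison hTw hTs.self_of_nhds hHz
    have hmono := cubeNorm_mono hHw.inv.posSemidef (posSemidef_conjTranspose_mul_self (A w))
      (by rw [hAA]; exact posSemidef_inv_sub_inv hHw hcmp) (y w)
    rw [hgram, ← hfw] at hmono
    exact sub_nonneg.2 (by exact_mod_cast hmono)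
  have hsplit : levi (fun w => (f w : ℂ)) z v =
      levi (fun w => (h w : ℂ)) z v + levi (fun w => ∑ p, q p w * conj (q p w)) z v := by
    rw [← levi_add (contDiffAt_ofReal_comp hhc) hsumc]
    refine levi_congr (Filter.Eventually.of_forall fun w => ?_) v
    simp only [hsum, hh]
    push_cast
    ring
  rw [hsplit]
  exact add_nonneg (levi_nonneg_of_isLocalMin hhc hmin v) (levi_sum_normSq_nonneg hqhol v)

end CubicNormPlurisubharmonic

/-! ### Invariance of the third derivatives under symplectic changes of periods. -/

section SymplecticInvariance

open Matrix

variable {r : ℕ}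

/-- The complex Hessian matrix `∂² F / ∂a^i ∂a^j`. -/
def hess (F : Cn r → ℂ) (a : Cn r) : Matrix (Fin r) (Fin r) ℂ :=
  Matrix.of fun i j => holPartial i (holPartial j F) a

lemma HolAt.hess_transpose {F : Cn r → ℂ} {a : Cn r} (hF : HolAt F a) : (hess F a)ᵀ = hess F a := by
  ext i j
  exact hF.holPartial_comm j i

lemma HolAt.matHolAt_hess {F : Cn r → ℂ} {a : Cn r} (hF : HolAt F a) : MatHolAt (hess F) a :=
  fun i j => (hF.holPartial j).holPartial i

lemma HolAt.matHolAt_hess_comp {F : Cn r → ℂ} {φ : Cn r → Cn r} {a : Cn r} (hF : HolAt F (φ a))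
    (hφ : ∀ i, HolAt (fun w => φ w i) a) : MatHolAt (fun w => hess F (φ w)) a :=
  fun i j => ((hF.holPartial j).holPartial i).comp hφ

/-- The Jacobian matrix `∂φ^a / ∂z^i`. -/
def jacobian (φ : Cn r → Cn r) (z : Cn r) : Matrix (Fin r) (Fin r) ℂ :=
  Matrix.of fun a i => holPartial i (fun w => φ w a) z

lemma differentiableAt_of_holAt {φ : Cn r → Cn r} {z : Cn r} (hφ : ∀ i, HolAt (fun w => φ w i) z) :
    DifferentiableAt ℂ φ z := differentiableAt_pi.2 fun i => (hφ i).differentiableAt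

lemma matHolAt_jacobian {φ : Cn r → Cn r} {z : Cn r} (hφ : ∀ i, HolAt (fun w => φ w i) z) :
    MatHolAt (jacobian φ) z := fun a i => (hφ a).holPartial i

lemma fderiv_single_apply {φ : Cn r → Cn r} {z : Cn r} (hφ : DifferentiableAt ℂ φ z)
    (a i : Fin r) : fderiv ℂ φ z (Pi.single i 1) a = jacobian φ z a i := by
  have := (hasFDerivAt_pi'.1 hφ.hasFDerivAt a).fderiv
  simp only [jacobian, Matrix.of_apply, holPartial]
  rw [this]
  rfl

lemma jacobian_comp {φ ψ : Cn r → Cn r} {z : Cn r} (hψ : DifferentiableAt ℂ ψ (φ z))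
    (hφ : DifferentiableAt ℂ φ z) :
    jacobian (fun w => ψ (φ w)) z = jacobian ψ (φ z) * jacobian φ z := by
  ext a i
  rw [Matrix.mul_apply]
  exact holPartial_comp (differentiableAt_pi.1 hψ a) hφ i

lemma jacobian_id (z : Cn r) : jacobian (fun w => w) z = 1 := by
  ext a i
  rw [← fderiv_single_apply (φ := fun w => w) differentiableAt_id, fderiv_fun_id]
  simp [Matrix.one_apply, Pi.single_apply]

lemma jacobian_congr {φ ψ : Cn r → Cn r} {z : Cn r} (h : φ =ᶠ[𝓝 z] ψ) :
    jacobian φ z = jacobian ψ z := by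
  ext a i
  exact holPartial_congr (h.mono fun w hw => by simp [hw]) i

lemma matHolPartial_hess_comp {F : Cn r → ℂ} {φ : Cn r → Cn r} {a : Cn r} (hF : HolAt F (φ a))
    (hφ : ∀ i, HolAt (fun w => φ w i) a) (k : Fin r) :
    matHolPartial k (fun w => hess F (φ w)) a = Matrix.of fun i j =>
      ∑ c, holPartial c (holPartial i (holPartial j F)) (φ a) * jacobian φ a c k := by
  ext i j
  exact holPartial_comp ((hF.holPartial j).holPartial i).differentiableAt
    (differentiableAt_of_holAt hφ) k

lemma holPartial_affine {f : Fin r → Cn r → ℂ} {z : Cn r} (hf : ∀ j, HolAt (f j) z)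
    (a b : Fin r → ℂ) (c : ℂ) (k : Fin r) :
    holPartial k (fun w => ∑ j, a j * f j w + ∑ j, b j * w j + c) z =
      ∑ j, a j * holPartial k (f j) z + b k := by
  have h1 : HasFDerivAt (fun w => ∑ j, a j * f j w) (∑ j, a j • fderiv ℂ (f j) z) z :=
    HasFDerivAt.fun_sum fun j _ => (hf j).differentiableAt.hasFDerivAt.const_mul (a j)
  have h2 : HasFDerivAt (fun w : Cn r => ∑ j, b j * w j)
      (∑ j, b j • (ContinuousLinearMap.proj j : Cn r →L[ℂ] ℂ)) z :=
    HasFDerivAt.fun_sum fun j _ => (hasFDerivAt_apply j z).const_mul (b j)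
  rw [holPartial, ((h1.fun_add h2).add_const c).fderiv]
  simp [holPartial, Pi.single_apply]

/-- If the periods `(∂F'/∂a'^i, a'^i)` and `(∂F/∂a^i, a^i)` are related by a constant symplectic matrix
and a constant shift, the third derivatives of the prepotentials transform as a cubic form. -/
lemma third_deriv_of_symplectic {F F' : Cn r → ℂ} {φ : Cn r → Cn r} {a : Cn r}
    (hF : HolAt F a) (hF' : HolAt F' (φ a)) (hφ : ∀ i, HolAt (fun w => φ w i) a)
    {P : Matrix (Fin r ⊕ Fin r) (Fin r ⊕ Fin r) ℂ} (hP : P ∈ Matrix.symplecticGroup (Fin r) ℂ)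
    {c : Fin r ⊕ Fin r → ℂ}
    (h : ∀ᶠ w in 𝓝 a, Sum.elim (fun i => holPartial i F' (φ w)) (φ w) =
      P.mulVec (Sum.elim (fun i => holPartial i F w) w) + c) (i j k : Fin r) :
    ∑ p, ∑ q, ∑ s, holPartial p (holPartial q (holPartial s F')) (φ a) *
      jacobian φ a p i * jacobian φ a q j * jacobian φ a s k =
      holPartial i (holPartial j (holPartial k F)) a := by
  obtain ⟨A, B, C, D, rfl⟩ : ∃ A B C D, P = fromBlocks A B C D :=
    ⟨_, _, _, _, (fromBlocks_toBlocks P).symm⟩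
  obtain ⟨hAC, -, hAD⟩ := SymplecticGroup.fromBlocks_mem_iff.1 hP
  have hDA : Dᵀ * A - Bᵀ * C = 1 := by
    have := congrArg Matrix.transpose hAD
    simpa using this
  have h1 : ∀ᶠ w in 𝓝 a, ∀ i, holPartial i F' (φ w) =
      ∑ j, A i j * holPartial j F w + ∑ j, B i j * w j + c (Sum.inl i) := by
    filter_upwards [h] with w hw i
    have := congrFun hw (Sum.inl i)
    simpa [fromBlocks_mulVec, mulVec, dotProduct] using this
  have h2 : ∀ᶠ w in 𝓝 a, ∀ i, φ w i =
      ∑ j, C i j * holPartial j F w + ∑ j, D i j * w j + c (Sum.inr i) := by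
    filter_upwards [h] with w hw i
    have := congrFun hw (Sum.inr i)
    simpa [fromBlocks_mulVec, mulVec, dotProduct] using this
  have hφc : Filter.Tendsto φ (𝓝 a) (𝓝 (φ a)) := (differentiableAt_of_holAt hφ).continuousAt
  -- One derivative of the period relation: with `T = ∂²F` and `T' = ∂²F' ∘ φ`, the lower half gives
  -- `J = CT + D` and the upper half `T'J = AT + B`. The shift drops out.
  have hJ : ∀ᶠ w in 𝓝 a, jacobian φ w = C * hess F w + D := by
    filter_upwards [h2.eventually_nhds, hF.eventually] with w hw hFw
    ext i k
    have e1 : (fun w => φ w i) =ᶠ[𝓝 w] fun w =>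
      ∑ j, C i j * holPartial j F w + ∑ j, D i j * w j + c (Sum.inr i) := hw.mono fun _ h => h i
    simp only [jacobian, Matrix.of_apply]
    rw [holPartial_congr e1, holPartial_affine fun j => hFw.holPartial j, Matrix.add_apply,
      Matrix.mul_apply]
    congr 1
    exact Finset.sum_congr rfl fun j _ => congrArg _ (hFw.holPartial_comm k j)
  have hT : ∀ᶠ w in 𝓝 a, hess F' (φ w) * jacobian φ w = A * hess F w + B := by
    filter_upwards [h1.eventually_nhds, hF.eventually, hφc.eventually hF'.eventually,
      Filter.eventually_all.2 fun i => (hφ i).eventually] with w hw hFw hFw' hφw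
    ext i k
    have e1 : (fun w => holPartial i F' (φ w)) =ᶠ[𝓝 w] fun w =>
      ∑ j, A i j * holPartial j F w + ∑ j, B i j * w j + c (Sum.inl i) := hw.mono fun _ h => h i
    have e2 := holPartial_comp (hFw'.holPartial i).differentiableAt
      (differentiableAt_of_holAt hφw) k
    rw [holPartial_congr e1, holPartial_affine fun j => hFw.holPartial j] at e2
    rw [Matrix.add_apply, Matrix.mul_apply, Matrix.mul_apply]
    have e3 : ∑ j, A i j * hess F w j k + B i k =
        ∑ j, A i j * holPartial k (holPartial j F) w + B i k := by
      congr 1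
      exact Finset.sum_congr rfl fun j _ => congrArg _ (hFw.holPartial_comm j k)
    rw [e3, e2]
    exact Finset.sum_congr rfl fun j _ => by
      rw [hess, Matrix.of_apply, hFw'.holPartial_comm i j]; rfl
  have hTh := hF'.matHolAt_hess_comp hφ
  have hJh := matHolAt_jacobian hφ
  have hconst : ∀ N : Matrix (Fin r) (Fin r) ℂ, MatHolAt (fun _ : Cn r => N) a :=
    fun N i j => holAt_const _
  have hconst0 : ∀ N : Matrix (Fin r) (Fin r) ℂ, matDz i (fun _ : Cn r => N) a = 0 := fun N => by
    ext p q
    exact dz_const _ _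
  have dJ : matHolPartial i (jacobian φ) a = C * matHolPartial i (hess F) a := by
    rw [← hJh.matDz_eq, matDz_congr hJ, matDz_add ((hconst C).matDiffAt.mul
      hF.matHolAt_hess.matDiffAt) (hconst D).matDiffAt, matDz_mul (hconst C).matDiffAt
      hF.matHolAt_hess.matDiffAt, hconst0, hconst0, hF.matHolAt_hess.matDz_eq]
    simp
  have dT : matHolPartial i (fun w => hess F' (φ w)) a * jacobian φ a +
      hess F' (φ a) * matHolPartial i (jacobian φ) a = A * matHolPartial i (hess F) a := by
    rw [← hJh.matDz_eq, ← hTh.matDz_eq, ← matDz_mul hTh.matDiffAt hJh.matDiffAt,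
      matDz_congr hT, matDz_add ((hconst A).matDiffAt.mul
      hF.matHolAt_hess.matDiffAt) (hconst B).matDiffAt, matDz_mul (hconst A).matDiffAt
      hF.matHolAt_hess.matDiffAt, hconst0, hconst0, hF.matHolAt_hess.matDz_eq]
    simp
  have hTJ : (jacobian φ a)ᵀ * hess F' (φ a) = hess F a * Aᵀ + Bᵀ := by
    have := congrArg Matrix.transpose hT.self_of_nhds
    simpa [hF'.hess_transpose, hF.hess_transpose] using this
  have hJt : (jacobian φ a)ᵀ = hess F a * Cᵀ + Dᵀ := by
    rw [hJ.self_of_nhds]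
    simp [hF.hess_transpose]
  -- The second derivative gives `∂T' J = (A - T'C) ∂T`. Multiplying by `Jᵀ` produces the factor
  -- `T(CᵀA - AᵀC) + (DᵀA - BᵀC)`, which is `1` by the symplectic relations.
  have key : (jacobian φ a)ᵀ * matHolPartial i (fun w => hess F' (φ w)) a * jacobian φ a =
      matHolPartial i (hess F) a := by
    rw [Matrix.mul_assoc, eq_sub_of_add_eq dT, dJ, mul_sub, ← Matrix.mul_assoc _ (hess F' (φ a)),
      hTJ, hJt]
    have : (hess F a * Cᵀ + Dᵀ) * (A * matHolPartial i (hess F) a) -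
        (hess F a * Aᵀ + Bᵀ) * (C * matHolPartial i (hess F) a) =
        (hess F a * (Cᵀ * A - Aᵀ * C) + (Dᵀ * A - Bᵀ * C)) * matHolPartial i (hess F) a := by
      noncomm_ring
    rw [this, hDA, hAC]
    simp
  have hkey := congrFun (congrFun key j) k
  -- The chain rule inside `∂_i T'` supplies the third Jacobian factor.
  rw [matHolPartial_hess_comp hF' hφ] at hkey
  rw [show holPartial i (holPartial j (holPartial k F)) a = matHolPartial i (hess F) a j k from rfl,
    ← hkey]
  simp only [Matrix.mul_apply, Finset.sum_mul, Finset.mul_sum, Matrix.of_apply,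
    Matrix.transpose_apply]
  rw [Finset.sum_comm]
  conv_rhs => rw [Finset.sum_comm]
  refine Finset.sum_congr rfl fun q _ => ?_
  rw [Finset.sum_comm]
  refine Finset.sum_congr rfl fun s _ => Finset.sum_congr rfl fun p _ => by ring

end SymplecticInvariance

/-! ### Coordinate changes and their Jacobians. -/

section Transition

open Matrix

variable {r : ℕ} {M : Type*} [TopologicalSpace M]
  {e e' e'' : OpenPartialHomeomorph M (Cn r)} {z : Cn r}

/-- The Jacobian matrix of the coordinate change from `e` to `e'`. -/
def jac (e e' : OpenPartialHomeomorph M (Cn r)) (z : Cn r) : Matrix (Fin r) (Fin r) ℂ :=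
  jacobian (fun w => e' (e.symm w)) z

lemma eventually_mem_target (hz : z ∈ e.target) (hz' : e.symm z ∈ e'.source) :
    ∀ᶠ w in 𝓝 z, w ∈ e.target ∧ e.symm w ∈ e'.source :=
  (e.open_target.eventually_mem hz).and
    ((e.continuousAt_symm hz).eventually (e'.open_source.eventually_mem hz'))

lemma jac_self (hz : z ∈ e.target) : jac e e z = 1 := by
  have hev : (fun w => e (e.symm w)) =ᶠ[𝓝 z] fun w => w := by
    filter_upwards [e.open_target.eventually_mem hz] with w hw using e.right_inv hw
  rw [jac, jacobian_congr hev, jacobian_id]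

variable [ChartedSpace (Cn r) M]

lemma mdifferentiableAt_chart (he : e ∈ holCharts r M) {p : M} (hp : p ∈ e.source) :
    MDifferentiableAt 𝓘(ℂ, Cn r) 𝓘(ℂ, Cn r) e p :=
  (contMDiffAt_of_mem_maximalAtlas he hp).mdifferentiableAt (by simp)

lemma mdifferentiableAt_chart_symm (he : e ∈ holCharts r M) (hz : z ∈ e.target) :
    MDifferentiableAt 𝓘(ℂ, Cn r) 𝓘(ℂ, Cn r) e.symm z :=
  (contMDiffAt_symm_of_mem_maximalAtlas he hz).mdifferentiableAt (by simp)

lemma holAt_transition (he : e ∈ holCharts r M) (he' : e' ∈ holCharts r M) (hz : z ∈ e.target)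
    (hz' : e.symm z ∈ e'.source) (i : Fin r) : HolAt (fun w => e' (e.symm w) i) z := by
  have h : ContMDiffAt 𝓘(ℂ, Cn r) 𝓘(ℂ, Cn r) ω (e' ∘ e.symm) z :=
    (contMDiffAt_of_mem_maximalAtlas he' hz').comp z (contMDiffAt_symm_of_mem_maximalAtlas he hz)
  have h2 : ContDiffAt ℂ ω (e' ∘ e.symm) z := contMDiffAt_iff_contDiffAt.1 h
  exact holAt_of_contDiffAt ((contDiffAt_pi.1 h2 i).of_le (by simp))

lemma differentiableAt_transition (he : e ∈ holCharts r M) (he' : e' ∈ holCharts r M)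
    (hz : z ∈ e.target) (hz' : e.symm z ∈ e'.source) :
    DifferentiableAt ℂ (fun w => e' (e.symm w)) z :=
  differentiableAt_of_holAt (holAt_transition he he' hz hz')

lemma vecCoord_coordVec (he : e ∈ holCharts r M) (he' : e' ∈ holCharts r M)
    (hz : z ∈ e.target) (hz' : e.symm z ∈ e'.source) (a i : Fin r) :
    vecCoord e' (e.symm z) (coordVec e z i) a = jac e e' z a i := by
  let A : Cn r →L[ℂ] Cn r := mfderiv 𝓘(ℂ, Cn r) 𝓘(ℂ, Cn r) e' (e.symm z)
  let B : Cn r →L[ℂ] Cn r := mfderiv 𝓘(ℂ, Cn r) 𝓘(ℂ, Cn r) e.symm z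
  have h : HasMFDerivAt 𝓘(ℂ, Cn r) 𝓘(ℂ, Cn r) (fun w => e' (e.symm w)) z (A.comp B) :=
    (mdifferentiableAt_chart he' hz').hasMFDerivAt.comp z
      (mdifferentiableAt_chart_symm he hz).hasMFDerivAt
  have h2 : HasFDerivAt (fun w => e' (e.symm w)) (A.comp B) z := h.hasFDerivAt
  rw [jac, ← fderiv_single_apply (differentiableAt_transition he he' hz hz'), h2.fderiv]
  rfl

/-- The chain rule for `e.symm = e'.symm ∘ (e' ∘ e.symm)`. Both sides are ascribed to `Cn r` because
their base points are equal only propositionally. -/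
lemma coordVec_eq_sum (he : e ∈ holCharts r M) (he' : e' ∈ holCharts r M)
    (hz : z ∈ e.target) (hz' : e.symm z ∈ e'.source) (i : Fin r) :
    (coordVec e z i : Cn r) =
      ∑ a, jac e e' z a i • (coordVec e' (e' (e.symm z)) a : Cn r) := by
  set φ : Cn r → Cn r := fun w => e' (e.symm w) with hφ
  have hd := differentiableAt_transition he he' hz hz'
  have h1 : HasMFDerivAt 𝓘(ℂ, Cn r) 𝓘(ℂ, Cn r) φ z (fderiv ℂ φ z) := hd.hasFDerivAt.hasMFDerivAt
  have h2 := (mdifferentiableAt_chart_symm he' (e'.map_source hz')).hasMFDerivAt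
  have h3 := h2.comp (f := φ) z h1
  have hev : e.symm =ᶠ[𝓝 z] e'.symm ∘ φ := by
    filter_upwards [eventually_mem_target hz hz'] with w hw
    simp [hφ, e'.left_inv hw.2]
  have h4 := h3.congr_of_eventuallyEq hev
  have h5 := h4.mfderiv
  let A : Cn r →L[ℂ] Cn r := mfderiv 𝓘(ℂ, Cn r) 𝓘(ℂ, Cn r) e'.symm (φ z)
  have h6 : (coordVec e z i : Cn r) = A (fderiv ℂ φ z (Pi.single i 1)) := by
    rw [coordVec, h5]
    rfl
  have h7 : fderiv ℂ φ z (Pi.single i 1) = ∑ a, jac e e' z a i • (Pi.single a 1 : Cn r) := by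
    ext b
    rw [fderiv_single_apply hd]
    simp [Finset.sum_apply, Pi.single_apply, jac]
  have h8 : A (∑ a, jac e e' z a i • (Pi.single a 1 : Cn r)) =
      ∑ a, jac e e' z a i • A (Pi.single a 1) := by simp only [map_sum, map_smul]
  rw [h6, h7]
  exact h8

lemma jac_comp (he : e ∈ holCharts r M) (he' : e' ∈ holCharts r M) (he'' : e'' ∈ holCharts r M)
    (hz : z ∈ e.target) (hz' : e.symm z ∈ e'.source) (hz'' : e.symm z ∈ e''.source) :
    jac e e'' z = jac e' e'' (e' (e.symm z)) * jac e e' z := by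
  have hev : (fun w => e'' (e.symm w)) =ᶠ[𝓝 z] fun w => e'' (e'.symm (e' (e.symm w))) := by
    filter_upwards [eventually_mem_target hz hz'] with w hw
    rw [e'.left_inv hw.2]
  rw [jac, jacobian_congr hev]
  exact jacobian_comp (ψ := fun v => e'' (e'.symm v)) (differentiableAt_transition he' he''
    (e'.map_source hz') (by rwa [e'.left_inv hz'])) (differentiableAt_transition he he' hz hz')

lemma isUnit_det_jac (he : e ∈ holCharts r M) (he' : e' ∈ holCharts r M)
    (hz : z ∈ e.target) (hz' : e.symm z ∈ e'.source) : IsUnit (jac e e' z).det := by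
  have := jac_comp he he' he hz hz' (e.map_target hz)
  rw [jac_self hz] at this
  exact (Matrix.isUnit_det_of_left_inverse this.symm)

end Transition

/-! ### The metric matrix: transformation law and positivity. -/

section Metric

open Matrix

variable {r : ℕ} {M : Type*} [TopologicalSpace M] [ChartedSpace (Cn r) M]
  (g : KahlerMetric r M)
  {e e' : OpenPartialHomeomorph M (Cn r)} {z : Cn r}

lemma KahlerMetric.form_sum_sum (p : M) (c d : Fin r → ℂ)
    (u : Fin r → TangentSpace 𝓘(ℂ, Cn r) p) :
    g.form p (∑ a, c a • u a) (∑ b, d b • u b) =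
      ∑ a, ∑ b, c a * g.form p (u a) (u b) * conj (d b) := by
  have h : g.form p (∑ a, c a • u a) = ∑ a, c a • g.form p (u a) := by
    simp only [map_sum, map_smul]
  rw [h, LinearMap.sum_apply]
  refine Finset.sum_congr rfl fun a _ => ?_
  rw [LinearMap.smul_apply, map_sum, Finset.smul_sum]
  refine Finset.sum_congr rfl fun b _ => ?_
  rw [LinearMap.map_smulₛₗ, smul_eq_mul, smul_eq_mul]
  ring

lemma KahlerMetric.coeff_transition (he : e ∈ holCharts r M) (he' : e' ∈ holCharts r M)
    (hz : z ∈ e.target) (hz' : e.symm z ∈ e'.source) :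
    g.coeff e z =
      (jac e e' z)ᵀ * g.coeff e' (e' (e.symm z)) * (jac e e' z).map (starRingEnd ℂ) := by
  -- Moves the base point along `e'.left_inv`; vectors are typed in `Cn r` so that no cast between
  -- tangent spaces appears.
  have hpt : ∀ (p q : M), p = q → ∀ u v : Cn r, g.form p u v = g.form q u v := by
    rintro p _ rfl u v
    rfl
  ext i j
  have h1 : g.coeff e z i j = g.form (e.symm z) (∑ a, jac e e' z a i •
      (coordVec e' (e' (e.symm z)) a : Cn r)) (∑ b, jac e e' z b j •
      (coordVec e' (e' (e.symm z)) b : Cn r)) :=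
    congrArg₂ (fun u v : Cn r => g.form (e.symm z) u v) (coordVec_eq_sum he he' hz hz' i)
      (coordVec_eq_sum he he' hz hz' j)
  rw [h1]
  refine (g.form_sum_sum (e.symm z) (fun a => jac e e' z a i) (fun a => jac e e' z a j)
    (fun a => (coordVec e' (e' (e.symm z)) a : Cn r))).trans ?_
  rw [Finset.sum_comm]
  simp only [Matrix.mul_apply, Finset.sum_mul, Matrix.transpose_apply, Matrix.map_apply]
  refine Finset.sum_congr rfl fun b _ => Finset.sum_congr rfl fun a _ => ?_
  congr 2
  exact hpt _ _ (e'.left_inv hz').symm _ _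

lemma coordVec_linearCombination_ne_zero (he : e ∈ holCharts r M) (hz : z ∈ e.target)
    {v : Cn r} (hv : v ≠ 0) : ∑ a, v a • coordVec e z a ≠ 0 := by
  intro h
  apply hv
  ext i
  have h1 := congrArg (fun u => vecCoord e (e.symm z) u i) h
  have h2 : vecCoord e (e.symm z) (∑ a, v a • coordVec e z a) i =
      ∑ a, v a * vecCoord e (e.symm z) (coordVec e z a) i := by
    simp only [vecCoord]
    rw [map_sum]
    refine (Finset.sum_apply i _ _).trans (Finset.sum_congr rfl fun a _ => ?_)
    rw [map_smul]
    rfl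
  simp only [h2, vecCoord_coordVec he he hz (e.map_target hz), jac_self hz] at h1
  have h3 : vecCoord e (e.symm z) 0 i = 0 := by
    rw [vecCoord, map_zero]
    rfl
  rw [h3] at h1
  simpa [Matrix.one_apply] using h1

lemma KahlerMetric.coeff_pos (he : e ∈ holCharts r M) (hz : z ∈ e.target) {v : Cn r}
    (hv : v ≠ 0) : 0 < ∑ i, ∑ j, g.coeff e z i j * v i * conj (v j) := by
  have h := g.pos (e.symm z) _ (coordVec_linearCombination_ne_zero he hz hv)
  rw [g.form_sum_sum] at h
  refine h.trans_eq (Finset.sum_congr rfl fun a _ => Finset.sum_congr rfl fun b _ => ?_)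
  rw [mul_comm (v a)]
  rfl

lemma KahlerMetric.coeff_posDef (he : e ∈ holCharts r M) (hz : z ∈ e.target) :
    (g.coeff e z).PosDef := by
  refine PosDef.of_dotProduct_mulVec_pos ?_ fun {x} hx => ?_
  · ext i j
    exact (g.hermitian _ _ _).symm
  -- `PosDef` conjugates the vector paired with the row index, whereas the form is linear in its
  -- first index; hence `star x`.
  · have hx' : star x ≠ 0 := by simpa using hx
    refine (g.coeff_pos he hz hx').trans_eq ?_
    simp only [dotProduct, mulVec, Finset.mul_sum]
    refine Finset.sum_congr rfl fun a _ => Finset.sum_congr rfl fun b _ => ?_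
    simp
    ring

end Metric

/-! ### Inverse metrics under a change of frame. -/

section FrameAlgebra

open Matrix

variable {r : ℕ}

lemma frame_inv {J H : Matrix (Fin r) (Fin r) ℂ} (hJ : IsUnit J.det) :
    J.map (starRingEnd ℂ) * (Jᵀ * H * J.map (starRingEnd ℂ))⁻¹ * Jᵀ = H⁻¹ := by
  have hJt : IsUnit Jᵀ.det := by rwa [det_transpose]
  have h : J.map (starRingEnd ℂ) * (Jᵀ * H * J.map (starRingEnd ℂ))⁻¹ * Jᵀ =
      (J.map (starRingEnd ℂ) * (J.map (starRingEnd ℂ))⁻¹) * H⁻¹ * (Jᵀ⁻¹ * Jᵀ) := by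
    rw [Matrix.mul_inv_rev, Matrix.mul_inv_rev]
    simp only [Matrix.mul_assoc]
  rw [h, mul_nonsing_inv _ (isUnit_det_map_conj hJ), nonsing_inv_mul _ hJt, Matrix.mul_one,
    Matrix.one_mul]

lemma twoIm_transpose {T : Matrix (Fin r) (Fin r) ℂ} (hT : Tᵀ = T) : (twoIm T)ᵀ = twoIm T := by
  rw [twoIm, transpose_add, transpose_smul, transpose_smul, ← transpose_map, hT]

end FrameAlgebra

/-! ### The global cubic form and the curvature formula. -/

section SpecialGeometry

open Matrix

variable {r : ℕ} {M : Type*} [TopologicalSpace M] [ChartedSpace (Cn r) M]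
  {g : KahlerMetric r M} {e : OpenPartialHomeomorph M (Cn r)} {z : Cn r}

namespace SpecialCoordinates

variable (x y : SpecialCoordinates g)

/-- The components `-√-1 ∂³F` of the cubic form in special coordinates. -/
def yukawa (a : Cn r) : Fin r → Fin r → Fin r → ℂ :=
  fun i j k => -Complex.I * x.thirdDeriv a i j k

variable {x} in
lemma holAt_prepotential {a : Cn r} (ha : a ∈ x.chart.target) : HolAt x.prepotential a := by
  filter_upwards [x.chart.open_target.eventually_mem ha] with w hw
  exact x.holomorphic.differentiableAt (x.chart.open_target.mem_nhds hw)

variable {x} in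
lemma thirdDeriv_swap_left {a : Cn r} (ha : a ∈ x.chart.target) (i j k : Fin r) :
    x.thirdDeriv a i j k = x.thirdDeriv a j i k :=
  ((holAt_prepotential ha).holPartial k).holPartial_comm i j

variable {x} in
lemma thirdDeriv_swap_right {a : Cn r} (ha : a ∈ x.chart.target) (i j k : Fin r) :
    x.thirdDeriv a i j k = x.thirdDeriv a i k j :=
  holPartial_congr ((holAt_prepotential ha).eventually.mono fun _ h => h.holPartial_comm j k) i

variable {x} in
lemma holAt_yukawa {a : Cn r} (ha : a ∈ x.chart.target) (i j k : Fin r) :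
    HolAt (fun w => x.yukawa w i j k) a :=
  (holAt_const _).mul ((((holAt_prepotential ha).holPartial k).holPartial j).holPartial i)

variable {x} in
lemma coeff_eq_twoIm {a : Cn r} (ha : a ∈ x.chart.target) :
    g.coeff x.chart a = twoIm (hess x.prepotential a) := by
  ext i j
  rw [x.metric_eq a ha]
  simp only [twoIm, hess, Matrix.add_apply, Matrix.smul_apply, Matrix.map_apply, Matrix.of_apply,
    smul_eq_mul]
  apply Complex.ext <;> simp
  ring

variable {x y} in
/-- The cubic forms of compatible special coordinates agree. -/
lemma Compatible.cubePull_yukawa (h : x.Compatible y) {a : Cn r} (ha : a ∈ x.chart.target)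
    (hy : x.chart.symm a ∈ y.chart.source) :
    cubePull (jac x.chart y.chart a) (y.yukawa (y.chart (x.chart.symm a))) = x.yukawa a := by
  obtain ⟨P, hP, c, hc⟩ := h (x.chart.symm a) ⟨x.chart.map_target ha, hy⟩
  have hPC : P.map Complex.ofReal ∈ Matrix.symplecticGroup (Fin r) ℂ :=
    SymplecticGroup.map_mem hP Complex.ofRealHom
  have hper : ∀ᶠ w in 𝓝 a, Sum.elim (fun i => holPartial i y.prepotential (y.chart
      (x.chart.symm w))) (y.chart (x.chart.symm w)) = (P.map Complex.ofReal).mulVec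
        (Sum.elim (fun i => holPartial i x.prepotential w) w) + c := by
    filter_upwards [(x.chart.continuousAt_symm ha).eventually hc,
      x.chart.open_target.eventually_mem ha] with w hw hwt
    simpa only [periods, x.chart.right_inv hwt] using hw
  funext i j k
  have hφ := holAt_transition x.chart_mem y.chart_mem ha hy
  have hFy := holAt_prepotential (y.chart.map_source hy)
  have h3 : ∑ p, ∑ q, ∑ s, y.thirdDeriv (y.chart (x.chart.symm a)) p q s *
      jac x.chart y.chart a p i * jac x.chart y.chart a q j * jac x.chart y.chart a s k =
      x.thirdDeriv a i j k :=
    third_deriv_of_symplectic (holAt_prepotential ha) hFy hφ hPC hper i j k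
  simp only [yukawa, cubePull]
  rw [← h3, Finset.mul_sum]
  refine Finset.sum_congr rfl fun p _ => ?_
  rw [Finset.mul_sum]
  refine Finset.sum_congr rfl fun q _ => ?_
  rw [Finset.mul_sum]
  refine Finset.sum_congr rfl fun s _ => ?_
  ring

end SpecialCoordinates

namespace SpecialStructure

variable (S : SpecialStructure g)

lemma systemAt_mem (p : M) : S.systemAt p ∈ S.systems := (S.cover p).choose_spec.1

lemma mem_systemAt_source (p : M) : p ∈ (S.systemAt p).chart.source := (S.cover p).choose_spec.2

/-- The system chosen in the definition of `Y` may jump from point to point. Compatibility and the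
chain rule replace it by any fixed system `x`, which can then be used throughout a neighbourhood. -/
lemma Y_eq_cubePull (he : e ∈ holCharts r M) (hz : z ∈ e.target) {x : SpecialCoordinates g}
    (hx : x ∈ S.systems) (hzx : e.symm z ∈ x.chart.source) :
    S.Y e z = cubePull (jac e x.chart z) (x.yukawa (x.chart (e.symm z))) := by
  set s := S.systemAt (e.symm z) with hs
  have hzs : e.symm z ∈ s.chart.source := S.mem_systemAt_source _
  have h1 : S.Y e z = cubePull (jac e s.chart z) (s.yukawa (s.chart (e.symm z))) := by
    funext i j k
    simp only [Y, cubicForm, ← hs, vecCoord_coordVec he s.chart_mem hz hzs]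
    rfl
  have hs' : x.chart.symm (x.chart (e.symm z)) ∈ s.chart.source := by
    rwa [x.chart.left_inv hzx]
  have h2 := (S.compatible x hx s (S.systemAt_mem _)).cubePull_yukawa
    (x.chart.map_source hzx) hs'
  rw [x.chart.left_inv hzx] at h2
  rw [h1, ← h2, cubePull_cubePull, ← jac_comp he x.chart_mem s.chart_mem hz hzx hzs]

lemma Y_special {x : SpecialCoordinates g} (hx : x ∈ S.systems) {a : Cn r}
    (ha : a ∈ x.chart.target) : S.Y x.chart a = x.yukawa a := by
  rw [S.Y_eq_cubePull x.chart_mem ha hx (x.chart.map_target ha), jac_self ha,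
    x.chart.right_inv ha]
  funext i j k
  simp [cubePull, Matrix.one_apply]

lemma holAt_Y (he : e ∈ holCharts r M) (hz : z ∈ e.target) (i j k : Fin r) :
    HolAt (fun w => S.Y e w i j k) z := by
  obtain ⟨x, hx, hzx⟩ := S.cover (e.symm z)
  have hJ := matHolAt_jacobian (holAt_transition he x.chart_mem hz hzx)
  have hy := fun a b c => (SpecialCoordinates.holAt_yukawa (x.chart.map_source hzx) a b c).comp
    (φ := fun w => x.chart (e.symm w)) (holAt_transition he x.chart_mem hz hzx)
  have hol : HolAt (fun w => cubePull (jac e x.chart w) (x.yukawa (x.chart (e.symm w))) i j k) z :=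
    HolAt.sum fun a _ => HolAt.sum fun b _ => HolAt.sum fun c _ =>
      (((hy a b c).mul (hJ a i)).mul (hJ b j)).mul (hJ c k)
  refine hol.congr ?_
  filter_upwards [eventually_mem_target hz hzx] with w hw
  rw [S.Y_eq_cubePull he hw.1 hx hw.2]

lemma cubicForm_swap_left (p : M) (u v w : TangentSpace 𝓘(ℂ, Cn r) p) :
    S.cubicForm p u v w = S.cubicForm p v u w := by
  have hp := (S.systemAt p).chart.map_source (S.mem_systemAt_source p)
  simp only [cubicForm]
  rw [Finset.sum_comm]
  refine Finset.sum_congr rfl fun j _ => Finset.sum_congr rfl fun i _ =>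
    Finset.sum_congr rfl fun k _ => ?_
  rw [SpecialCoordinates.thirdDeriv_swap_left hp]
  ring

lemma cubicForm_swap_right (p : M) (u v w : TangentSpace 𝓘(ℂ, Cn r) p) :
    S.cubicForm p u v w = S.cubicForm p u w v := by
  have hp := (S.systemAt p).chart.map_source (S.mem_systemAt_source p)
  simp only [cubicForm]
  refine Finset.sum_congr rfl fun i _ => ?_
  rw [Finset.sum_comm]
  refine Finset.sum_congr rfl fun k _ => Finset.sum_congr rfl fun j _ => ?_
  rw [SpecialCoordinates.thirdDeriv_swap_right hp]
  ring

end SpecialStructure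

lemma KahlerMetric.coeff_eq_frame (he : e ∈ holCharts r M) (hz : z ∈ e.target)
    {x : SpecialCoordinates g} (hzx : e.symm z ∈ x.chart.source) :
    g.coeff e z = (jac e x.chart z)ᵀ * twoIm (hess x.prepotential (x.chart (e.symm z))) *
      (jac e x.chart z).map (starRingEnd ℂ) := by
  rw [g.coeff_transition he x.chart_mem hz hzx,
    SpecialCoordinates.coeff_eq_twoIm (x.chart.map_source hzx)]

lemma SpecialCoordinates.twoIm_posDef {x : SpecialCoordinates g} {a : Cn r}
    (ha : a ∈ x.chart.target) : (twoIm (hess x.prepotential a)).PosDef := by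
  rw [← coeff_eq_twoIm ha]
  exact g.coeff_posDef x.chart_mem ha

lemma KahlerMetric.riemann_eq_matrix (g : KahlerMetric r M) (e : OpenPartialHomeomorph M (Cn r))
    (z : Cn r) (i j k l : Fin r) :
    g.riemann e z i j k l = (-matDz k (matDzbar l (g.coeff e)) z +
      matDz k (g.coeff e) z * (g.coeff e z)⁻¹ * matDzbar l (g.coeff e) z) i j := by
  rw [Matrix.add_apply, Matrix.mul_apply]
  simp only [Matrix.mul_apply, Finset.sum_mul]
  rw [Finset.sum_comm]
  refine congrArg₂ (· + ·) rfl ?_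
  refine Finset.sum_congr rfl fun n _ => Finset.sum_congr rfl fun m _ => ?_
  simp only [inv, matDz, matDzbar, Matrix.of_apply]
  ring

/-- The curvature formula `R_{i j̄ k l̄} = G^{n̄ m} Y_{ikm} Ȳ_{jln}`. -/
lemma SpecialStructure.riemann_eq (S : SpecialStructure g) (he : e ∈ holCharts r M)
    (hz : z ∈ e.target) (i j k l : Fin r) :
    g.riemann e z i j k l =
      ∑ n, ∑ m, g.inv e z n m * S.Y e z i k m * conj (S.Y e z j l n) := by
  obtain ⟨x, hx, hzx⟩ := S.cover (e.symm z)
  set φ : Cn r → Cn r := fun w => x.chart (e.symm w) with hφdef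
  have hφ := holAt_transition he x.chart_mem hz hzx
  have hat : φ z ∈ x.chart.target := x.chart.map_source hzx
  have hF := SpecialCoordinates.holAt_prepotential hat
  set J : Cn r → Matrix (Fin r) (Fin r) ℂ := jac e x.chart with hJdef
  set T : Cn r → Matrix (Fin r) (Fin r) ℂ := fun w => hess x.prepotential (φ w) with hTdef
  have hJ : MatHolAt J z := matHolAt_jacobian hφ
  have hT : MatHolAt T z := hF.matHolAt_hess_comp hφ
  have hJu : IsUnit (J z).det := isUnit_det_jac he x.chart_mem hz hzx
  have hHu : IsUnit (twoIm (T z)).det :=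
    (isUnit_iff_isUnit_det _).1 (SpecialCoordinates.twoIm_posDef hat).isUnit
  have hG : ∀ᶠ w in 𝓝 z, g.coeff e w = (J w)ᵀ * twoIm (T w) * (J w).map (starRingEnd ℂ) := by
    filter_upwards [eventually_mem_target hz hzx] with w hw
    exact g.coeff_eq_frame he hw.1 hw.2
  have hdT : ∀ k, matHolPartial k T z = Matrix.of fun a c =>
      ∑ b, x.thirdDeriv (φ z) b a c * J z b k := fun k => matHolPartial_hess_comp hF hφ k
  have hdTs : ∀ k, (matHolPartial k T z)ᵀ = matHolPartial k T z := fun k => by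
    rw [hdT]
    ext a c
    simp only [Matrix.transpose_apply, Matrix.of_apply]
    exact Finset.sum_congr rfl fun b _ => by
      rw [SpecialCoordinates.thirdDeriv_swap_right hat]
  -- The outer Jacobians carry the indices `i` and `m`; the one for `k` is already in `∂_k T` by the
  -- chain rule.
  have hY : ∀ k, (Matrix.of fun i m => S.Y e z i k m) =
      (J z)ᵀ * ((-Complex.I) • matHolPartial k T z) * J z := fun k => by
    ext i m
    rw [S.Y_eq_cubePull he hz hx hzx, hdT]
    simp only [cubePull, SpecialCoordinates.yukawa, Matrix.of_apply, Matrix.mul_apply,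
      Matrix.smul_apply, smul_eq_mul, Matrix.transpose_apply, Finset.sum_mul, Finset.mul_sum]
    conv_rhs => rw [Finset.sum_comm]
    refine Finset.sum_congr rfl fun a _ => ?_
    rw [Finset.sum_comm]
    refine Finset.sum_congr rfl fun c _ => Finset.sum_congr rfl fun b _ => ?_
    rw [SpecialCoordinates.thirdDeriv_swap_left hat]
    ring
  -- Contracting `Y_{ikm} G^{n̄m} Ȳ_{jln}` as a matrix product puts the inverse metric in
  -- transposed. `frame_inv` can be transposed to match because `2 Im T` is symmetric.
  have hK : (J z) * (g.inv e z)ᵀ * (J z)ᴴ = (twoIm (T z))⁻¹ := by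
    have h := frame_inv (H := twoIm (T z)) hJu
    rw [← hG.self_of_nhds] at h
    have h2 := congrArg Matrix.transpose h
    rw [transpose_nonsing_inv, twoIm_transpose hF.hess_transpose] at h2
    rw [← h2, transpose_mul, transpose_mul, transpose_transpose, Matrix.mul_assoc]
    rfl
  have hsum : ∑ n, ∑ m, g.inv e z n m * S.Y e z i k m * conj (S.Y e z j l n) =
      ((Matrix.of fun i m => S.Y e z i k m) * (g.inv e z)ᵀ *
        (Matrix.of fun j n => S.Y e z j l n)ᴴ) i j := by
    simp only [Matrix.mul_apply, Finset.sum_mul, Matrix.of_apply, Matrix.transpose_apply,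
      Matrix.conjTranspose_apply, RCLike.star_def]
    refine Finset.sum_congr rfl fun n _ => Finset.sum_congr rfl fun m _ => by ring
  have hmap : (Complex.I • (matHolPartial l T z).map (starRingEnd ℂ)) =
      ((-Complex.I) • matHolPartial l T z)ᴴ := by
    conv_rhs => rw [← hdTs]
    rw [conjTranspose_smul]
    simp only [star_neg, RCLike.star_def, Complex.conj_I, neg_neg]
    rfl
  rw [g.riemann_eq_matrix, curvature_of_frame hJ hT hG hJu hHu, hsum, hY, hY, ← hK, hmap,
    conjTranspose_mul, conjTranspose_mul]
  simp only [Matrix.mul_assoc]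
  rfl

end SpecialGeometry

/-! ### Positivity, scalar curvature and plurisubharmonicity. -/

section Curvature

open Matrix

variable {r : ℕ}

lemma nakano_sum_eq (K : Matrix (Fin r) (Fin r) ℂ) (y : Fin r → Fin r → Fin r → ℂ)
    (u : Fin r → Fin r → ℂ) :
    ∑ i, ∑ j, ∑ k, ∑ l, (∑ n, ∑ m, K n m * y i k m * conj (y j l n)) * u i k * conj (u j l) =
      star (fun m => ∑ i, ∑ k, y i k m * u i k) ⬝ᵥ
        (K *ᵥ fun m => ∑ i, ∑ k, y i k m * u i k) := by
  have h1 : ∑ i, ∑ j, ∑ k, ∑ l, (∑ n, ∑ m, K n m * y i k m * conj (y j l n)) * u i k *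
      conj (u j l) = ∑ q : Fin r × Fin r × Fin r × Fin r × Fin r × Fin r,
      conj (y q.2.1 q.2.2.2.1 q.2.2.2.2.1) * conj (u q.2.1 q.2.2.2.1) *
      (K q.2.2.2.2.1 q.2.2.2.2.2 * (y q.1 q.2.2.1 q.2.2.2.2.2 * u q.1 q.2.2.1)) := by
    simp only [Fintype.sum_prod_type, Finset.sum_mul]
    refine Finset.sum_congr rfl fun i _ => Finset.sum_congr rfl fun j _ =>
      Finset.sum_congr rfl fun k _ => Finset.sum_congr rfl fun l _ =>
      Finset.sum_congr rfl fun n _ => Finset.sum_congr rfl fun m _ => by ring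
  have h2 : star (fun m => ∑ i, ∑ k, y i k m * u i k) ⬝ᵥ
      (K *ᵥ fun m => ∑ i, ∑ k, y i k m * u i k) =
      ∑ q : Fin r × Fin r × Fin r × Fin r × Fin r × Fin r,
      conj (y q.2.2.2.2.1 q.2.2.2.2.2 q.1) * conj (u q.2.2.2.2.1 q.2.2.2.2.2) *
      (K q.1 q.2.1 * (y q.2.2.1 q.2.2.2.1 q.2.1 * u q.2.2.1 q.2.2.2.1)) := by
    simp only [Fintype.sum_prod_type, dotProduct, mulVec, Pi.star_apply, RCLike.star_def, map_sum,
      map_mul, Finset.sum_mul, Finset.mul_sum]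
  rw [h1, h2]
  exact Fintype.sum_equiv
    ⟨fun (i, j, k, l, n, m) => (n, m, i, k, j, l), fun (n, m, i, k, j, l) => (i, j, k, l, n, m),
      fun _ => rfl, fun _ => rfl⟩ _ _ fun _ => by simp only [Equiv.coe_fn_mk]

/-- Each summand in `s` on the right is the Nakano form at `u^{ik} = B_{si} v^k`. -/
lemma ricci_sum_eq (B : Matrix (Fin r) (Fin r) ℂ) (R : Fin r → Fin r → Fin r → Fin r → ℂ)
    (v : Cn r) :
    ∑ k, ∑ l, (∑ i, ∑ j, (Bᴴ * B) j i * R i j k l) * v k * conj (v l) =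
      ∑ s, ∑ i, ∑ j, ∑ k, ∑ l, R i j k l * (B s i * v k) * conj (B s j * v l) := by
  have h1 : ∑ k, ∑ l, (∑ i, ∑ j, (Bᴴ * B) j i * R i j k l) * v k * conj (v l) =
      ∑ q : Fin r × Fin r × Fin r × Fin r × Fin r, R q.2.2.1 q.2.2.2.1 q.1 q.2.1 *
        (B q.2.2.2.2 q.2.2.1 * v q.1) * conj (B q.2.2.2.2 q.2.2.2.1 * v q.2.1) := by
    simp only [Fintype.sum_prod_type, Finset.sum_mul, Matrix.mul_apply, conjTranspose_apply,
      RCLike.star_def, map_mul]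
    refine Finset.sum_congr rfl fun i _ => Finset.sum_congr rfl fun j _ =>
      Finset.sum_congr rfl fun k _ => Finset.sum_congr rfl fun l _ =>
      Finset.sum_congr rfl fun n _ => by ring
  have h2 : ∑ s, ∑ i, ∑ j, ∑ k, ∑ l, R i j k l * (B s i * v k) * conj (B s j * v l) =
      ∑ q : Fin r × Fin r × Fin r × Fin r × Fin r, R q.2.1 q.2.2.1 q.2.2.2.1 q.2.2.2.2 *
        (B q.1 q.2.1 * v q.2.2.2.1) * conj (B q.1 q.2.2.1 * v q.2.2.2.2) := by
    simp only [Fintype.sum_prod_type]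
  rw [h1, h2]
  exact Fintype.sum_equiv
    ⟨fun (k, l, i, j, s) => (s, i, j, k, l), fun (s, i, j, k, l) => (k, l, i, j, s),
      fun _ => rfl, fun _ => rfl⟩ _ _ fun _ => by simp only [Equiv.coe_fn_mk]

lemma scalar_sum_eq (K : Matrix (Fin r) (Fin r) ℂ) (y : Fin r → Fin r → Fin r → ℂ) :
    ∑ k, ∑ l, K l k * ∑ i, ∑ j, K j i * ∑ n, ∑ m, K n m * y i k m * conj (y j l n) =
      cubeNorm K y := by
  have h1 : ∑ k, ∑ l, K l k * ∑ i, ∑ j, K j i * ∑ n, ∑ m, K n m * y i k m * conj (y j l n) =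
      ∑ q : Fin r × Fin r × Fin r × Fin r × Fin r × Fin r,
        y q.2.2.1 q.1 q.2.2.2.2.2 * K q.2.2.2.1 q.2.2.1 * K q.2.1 q.1 *
          K q.2.2.2.2.1 q.2.2.2.2.2 * conj (y q.2.2.2.1 q.2.1 q.2.2.2.2.1) := by
    simp only [Fintype.sum_prod_type, Finset.mul_sum]
    refine Finset.sum_congr rfl fun i _ => Finset.sum_congr rfl fun j _ =>
      Finset.sum_congr rfl fun k _ => Finset.sum_congr rfl fun l _ =>
      Finset.sum_congr rfl fun n _ => Finset.sum_congr rfl fun m _ => by ring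
  have h2 : cubeNorm K y = ∑ q : Fin r × Fin r × Fin r × Fin r × Fin r × Fin r,
      y q.1 q.2.1 q.2.2.1 * K q.2.2.2.1 q.1 * K q.2.2.2.2.1 q.2.1 * K q.2.2.2.2.2 q.2.2.1 *
        conj (y q.2.2.2.1 q.2.2.2.2.1 q.2.2.2.2.2) := by
    rw [cubeNorm_eq_sum]
    simp only [Fintype.sum_prod_type]
  rw [h1, h2]
  exact Fintype.sum_equiv
    ⟨fun (k, l, i, j, n, m) => (i, k, m, j, l, n), fun (i, k, m, j, l, n) => (k, l, i, j, n, m),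
      fun _ => rfl, fun _ => rfl⟩ _ _ fun _ => by simp only [Equiv.coe_fn_mk]

variable {M : Type*} [TopologicalSpace M] [ChartedSpace (Cn r) M]
  {g : KahlerMetric r M} {e : OpenPartialHomeomorph M (Cn r)} {z : Cn r}

lemma SpecialStructure.isNakanoNonneg (S : SpecialStructure g) : g.IsNakanoNonneg := by
  intro e he z hz u
  simp only [S.riemann_eq he hz]
  rw [nakano_sum_eq]
  exact (g.coeff_posDef he hz).inv.posSemidef.dotProduct_mulVec_nonneg _

lemma KahlerMetric.IsNakanoNonneg.isBisectionalNonneg (h : g.IsNakanoNonneg) :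
    g.IsBisectionalNonneg := by
  intro e he z hz v w hv hw
  refine mul_nonneg ?_ (inv_nonneg.2 (mul_pos (g.coeff_pos he hz hv) (g.coeff_pos he hz hw)).le)
  refine (h e he z hz fun i k => v i * w k).trans_eq ?_
  refine Finset.sum_congr rfl fun i _ => Finset.sum_congr rfl fun j _ =>
    Finset.sum_congr rfl fun k _ => Finset.sum_congr rfl fun l _ => ?_
  rw [map_mul]
  ring

lemma KahlerMetric.IsNakanoNonneg.isRicciNonneg (h : g.IsNakanoNonneg) : g.IsRicciNonneg := by
  intro e he z hz v
  obtain ⟨B, hB⟩ : ∃ B : Matrix (Fin r) (Fin r) ℂ, g.inv e z = Bᴴ * B := by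
    open scoped MatrixOrder in
    exact CStarAlgebra.nonneg_iff_eq_star_mul_self.1
      (nonneg_iff_posSemidef.2 (g.coeff_posDef he hz).inv.posSemidef)
  simp only [KahlerMetric.ricci, hB]
  rw [ricci_sum_eq]
  exact Finset.sum_nonneg fun s _ => h e he z hz fun i k => B s i * v k

namespace SpecialStructure

variable (S : SpecialStructure g)

lemma normSqY_eq_cubeNorm (e : OpenPartialHomeomorph M (Cn r)) (z : Cn r) :
    S.normSqY e z = cubeNorm (g.inv e z) (S.Y e z) := (cubeNorm_eq_sum _ _).symm

lemma scalarIn_eq_normSqY (he : e ∈ holCharts r M) (hz : z ∈ e.target) :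
    g.scalarIn e z = S.normSqY e z := by
  rw [normSqY_eq_cubeNorm, ← scalar_sum_eq]
  simp only [KahlerMetric.scalarIn, KahlerMetric.ricci, S.riemann_eq he hz]

/-- The right side depends on `e` and `z` only through the point `e.symm z`, whence chart
independence of the scalar curvature. -/
lemma scalarIn_eq_special (he : e ∈ holCharts r M) (hz : z ∈ e.target)
    {x : SpecialCoordinates g} (hx : x ∈ S.systems) (hzx : e.symm z ∈ x.chart.source) :
    g.scalarIn e z = cubeNorm (twoIm (hess x.prepotential (x.chart (e.symm z))))⁻¹
      (x.yukawa (x.chart (e.symm z))) := by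
  rw [S.scalarIn_eq_normSqY he hz, normSqY_eq_cubeNorm, S.Y_eq_cubePull he hz hx hzx,
    cubeNorm_cubePull, KahlerMetric.inv, g.coeff_eq_frame he hz hzx,
    frame_inv (isUnit_det_jac he x.chart_mem hz hzx)]

variable [IsManifold 𝓘(ℂ, Cn r) ω M]

lemma scalar_eq_special {p : M} {x : SpecialCoordinates g} (hx : x ∈ S.systems)
    (hp : p ∈ x.chart.source) : (g.scalar p : ℂ) =
      cubeNorm (twoIm (hess x.prepotential (x.chart p)))⁻¹ (x.yukawa (x.chart p)) := by
  have hc : chartAt (Cn r) p ∈ holCharts r M := IsManifold.chart_mem_maximalAtlas p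
  have hps := mem_chart_source (Cn r) p
  have hinv := (chartAt (Cn r) p).left_inv hps
  have h := S.scalarIn_eq_special hc ((chartAt (Cn r) p).map_source hps) hx (by rwa [hinv])
  rw [hinv] at h
  have h0 := cubeNorm_nonneg (SpecialCoordinates.twoIm_posDef
    (x.chart.map_source hp)).inv.posSemidef (x.yukawa (x.chart p))
  rw [KahlerMetric.scalar, h]
  -- Non-negativity in the order of `ℂ` includes being real, so the `.re` in `scalar` loses nothing.
  exact (Complex.eq_re_of_ofReal_le h0).symm

lemma scalarIn_eq_scalar (S : SpecialStructure g) (he : e ∈ holCharts r M) (hz : z ∈ e.target) :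
    g.scalarIn e z = (g.scalar (e.symm z) : ℂ) := by
  obtain ⟨x, hx, hzx⟩ := S.cover (e.symm z)
  rw [S.scalarIn_eq_special he hz hx hzx, S.scalar_eq_special hx hzx]

lemma yukawa_eq_zero_of_scalar_eq_zero {p : M} (h : g.scalar p = 0) {x : SpecialCoordinates g}
    (hx : x ∈ S.systems) (hp : p ∈ x.chart.source) : x.yukawa (x.chart p) = fun _ _ _ => 0 := by
  have h1 := S.scalar_eq_special hx hp
  rw [h, Complex.ofReal_zero] at h1
  funext i j k
  exact eq_zero_of_cubeNorm_eq_zero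
    (SpecialCoordinates.twoIm_posDef (x.chart.map_source hp)).inv h1.symm i j k

lemma cubicForm_eq_zero_of_scalar_eq_zero {p : M} (h : g.scalar p = 0)
    (u v w : TangentSpace 𝓘(ℂ, Cn r) p) : S.cubicForm p u v w = 0 := by
  have h0 := S.yukawa_eq_zero_of_scalar_eq_zero h (S.systemAt_mem p) (S.mem_systemAt_source p)
  refine Finset.sum_eq_zero fun i _ => Finset.sum_eq_zero fun j _ =>
    Finset.sum_eq_zero fun k _ => ?_
  have h1 : -Complex.I * (S.systemAt p).thirdDeriv ((S.systemAt p).chart p) i j k = 0 :=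
    congrFun (congrFun (congrFun h0 i) j) k
  rw [h1, zero_mul, zero_mul, zero_mul]

lemma riemann_eq_zero_of_scalar_eq_zero (S : SpecialStructure g) {p : M} (h : g.scalar p = 0) (he : e ∈ holCharts r M)
    (hp : p ∈ e.source) (i j k l : Fin r) : g.riemann e (e p) i j k l = 0 := by
  have hY : S.Y e (e p) = fun _ _ _ => 0 := by
    obtain ⟨x, hx, hpx⟩ := S.cover p
    rw [S.Y_eq_cubePull he (e.map_source hp) hx (by rwa [e.left_inv hp]), e.left_inv hp,
      S.yukawa_eq_zero_of_scalar_eq_zero h hx hpx, cubePull_zero]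
  rw [S.riemann_eq he (e.map_source hp), hY]
  simp

/-- As `scalar` is given by special data at the point, in any chart it is the cubic norm of `T ∘ φ`
and `y ∘ φ` with `φ` the holomorphic coordinate change; no Jacobian enters. -/
lemma isPlurisubharmonic_scalar (S : SpecialStructure g) : IsPlurisubharmonic (r := r) g.scalar := by
  intro e he
  have key : ∀ z ∈ e.target, ContDiffAt ℝ ∞ (fun z => g.scalar (e.symm z)) z ∧
      ∀ v, 0 ≤ levi (fun x => (g.scalar (e.symm x) : ℂ)) z v := by
    intro z hz
    obtain ⟨x, hx, hzx⟩ := S.cover (e.symm z)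
    have hφ := holAt_transition he x.chart_mem hz hzx
    have hat := x.chart.map_source hzx
    have hF := SpecialCoordinates.holAt_prepotential hat
    have hev := eventually_mem_target hz hzx
    refine contDiffAt_and_levi_nonneg (T := fun w => hess x.prepotential (x.chart (e.symm w)))
      (y := fun w => x.yukawa (x.chart (e.symm w)))
      (hF.matHolAt_hess_comp (φ := fun w => x.chart (e.symm w)) hφ) ?_ ?_ ?_ ?_
    · filter_upwards [hev] with w hw
      exact (SpecialCoordinates.holAt_prepotential (x.chart.map_source hw.2)).hess_transpose
    · filter_upwards [hev] with w hw
      exact SpecialCoordinates.twoIm_posDef (x.chart.map_source hw.2)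
    · exact fun i j k => (SpecialCoordinates.holAt_yukawa hat i j k).comp
        (φ := fun w => x.chart (e.symm w)) hφ
    · filter_upwards [hev] with w hw
      exact S.scalar_eq_special hx hw.2
  exact ⟨fun z hz => (key z hz).1.contDiffWithinAt, fun z hz v => (key z hz).2 v⟩

end SpecialStructure

end Curvature

end SpecialKahler

end

theorem mainTheorem5 {r : ℕ} {M : Type*} [TopologicalSpace M] [ChartedSpace (Cn r) M]
    [IsManifold 𝓘(ℂ, Cn r) ω M] (g : KahlerMetric r M) (S : SpecialStructure g) :
    -- `Y` is `-√-1 ∂³F` in all special coordinates, and is symmetric and holomorphic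
    (∀ x ∈ S.systems, ∀ a ∈ x.chart.target, ∀ i j k,
      S.Y x.chart a i j k = -Complex.I * x.thirdDeriv a i j k) ∧
    (∀ p u v w, S.cubicForm p u v w = S.cubicForm p v u w ∧
      S.cubicForm p u v w = S.cubicForm p u w v) ∧
    (∀ e ∈ holCharts r M, ∀ i j k, DifferentiableOn ℂ (fun z => S.Y e z i j k) e.target) ∧
    -- the curvature formula, in all holomorphic coordinates
    (∀ e ∈ holCharts r M, ∀ z ∈ e.target, ∀ i j k l,
      g.riemann e z i j k l =
        ∑ n, ∑ m, g.inv e z n m * S.Y e z i k m * conj (S.Y e z j l n)) ∧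
    -- (1)
    g.IsNakanoNonneg ∧ g.IsBisectionalNonneg ∧ g.IsRicciNonneg ∧
    -- (2)
    (∀ e ∈ holCharts r M, ∀ z ∈ e.target,
      g.scalarIn e z = (g.scalar (e.symm z) : ℂ) ∧
      (g.scalar (e.symm z) : ℂ) = S.normSqY e z) ∧
    (∀ p : M, g.scalar p = 0 →
      (∀ u v w, S.cubicForm p u v w = 0) ∧
      ∀ e ∈ holCharts r M, p ∈ e.source → ∀ i j k l, g.riemann e (e p) i j k l = 0) ∧
    -- (3)
    IsPlurisubharmonic (r := r) g.scalar := by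
  refine ⟨fun x hx a ha i j k => ?_, fun p u v w => ⟨S.cubicForm_swap_left p u v w,
    S.cubicForm_swap_right p u v w⟩, fun e he i j k z hz =>
    (S.holAt_Y he hz i j k).differentiableAt.differentiableWithinAt,
    fun e he z hz i j k l => S.riemann_eq he hz i j k l, S.isNakanoNonneg,
    S.isNakanoNonneg.isBisectionalNonneg, S.isNakanoNonneg.isRicciNonneg,
    fun e he z hz => ⟨S.scalarIn_eq_scalar he hz, ?_⟩, fun p hp =>
    ⟨S.cubicForm_eq_zero_of_scalar_eq_zero hp, fun e he hpe =>
      S.riemann_eq_zero_of_scalar_eq_zero hp he hpe⟩, S.isPlurisubharmonic_scalar⟩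
  · rw [S.Y_special hx ha]
    rfl
  · rw [← S.scalarIn_eq_scalar he hz, S.scalarIn_eq_normSqY he hz]
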